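/- Let $(X,\mu)$ be a $\sigma$-finite nonatomic measure space with $\mu(X)>0$ (finite or infinite), and let $T:X\to X$ be an invertible measure-preserving transformation. A (Rokhlin) column of height $h\ge 1$ with base $B$ is a family of pairwise disjoint measurable sets $B,TB,\dots,T^{h-1}B$, called its levels. $T$ is rank-one if there is a sequence of columns $C_n$ that approximates every measurable set of finite measure: for every measurable $A$ with $\mu(A)<\infty$ and every $\varepsilon>0$ there is $N$ such that for each $n\ge N$ some union $B'$ of levels of $C_n$ satisfies $\mu(A\triangle B')<\varepsilon$. A cutting-and-stacking presentation of $T$ consists of columns $C_n$ with bases $B_n$ and heights $h_n$ $(n\ge 0)$ that approximate every measurable set of finite measure, together with integers $r_n\ge 2$ and $s_{n,k}\ge 0$, such that $C_0=\{I\}$ is a single set with $0<\mu(I)<\infty$ and $C_{n+1}$ is obtained by cutting $C_n$ into $r_n$ subcolumns, placing $s_{n,k}$ spacers above the $k$-th one, and stacking; that is, $h_{n+1}=\sum_{k=0}^{r_n-1}(h_n+s_{n,k})$ and $B_n=\bigcup_{i=0}^{r_n-1}T^{\,\sum_{k<i}(h_n+s_{n,k})}B_{n+1}$. For such a presentation let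 $M_m$ be the largest $i\in\{0,\dots,h_m-1\}$ with $T^iB_m\subset I$. For $F$ measurable with $0<\mu(F)<\infty$ put $a_n(F)=\sum_{k=0}^{n-1}\mu(F\cap T^kF)/\mu(F)^2$. **Theorem.** Let $T$ be rank-one. Then $T$ has a cutting-and-stacking presentation; and for every cutting-and-stacking presentation of $T$, $T$ is subsequence weakly rationally ergodic along the sequence $n_m=M_m+1$ $(m\ge 0)$ with respect to the base level $I$. That is, $(n_m)$ is strictly increasing, $\mu\big(X\setminus\bigcup_{i\ge 0}T^iI\big)=0$, and for all measurable $A,B\subset I$, $$\frac{1}{a_{n_m}(I)}\sum_{k=0}^{n_m-1}\mu(A\cap T^kB)\longrightarrow\mu(A)\mu(B)\qquad(m\to\infty).$$ -/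

import Mathlib

open MeasureTheory Filter Topology

namespace RankOne

variable {X : Type*} [MeasurableSpace X]

/-- A measure is nonatomic if every measurable set of positive measure has a measurable subset
of strictly smaller positive measure. -/
def IsNonatomic (μ : Measure X) : Prop :=
  ∀ A : Set X, MeasurableSet A → 0 < μ A →
    ∃ B : Set X, B ⊆ A ∧ MeasurableSet B ∧ 0 < μ B ∧ μ B < μ A

/-- The image `T^k(A)`. -/
def img (T : X ≃ᵐ X) (k : ℕ) (A : Set X) : Set X := (⇑T)^[k] '' A

/-- `B, T(B), …, T^(h-1)(B)` is a Rokhlin column: measurable, pairwise disjoint levels. -/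
structure IsColumn (T : X ≃ᵐ X) (B : Set X) (h : ℕ) : Prop where
  height_pos : 0 < h
  measurable_base : MeasurableSet B
  disjoint_levels : ∀ i < h, ∀ j < h, i ≠ j → Disjoint (img T i B) (img T j B)

/-- The columns with bases `B n` and heights `h n` approximate every measurable set of finite
measure: for each `ε > 0` and all large `n`, some union of levels of the `n`-th column is
`ε`-close to the set. -/
def Approximates (T : X ≃ᵐ X) (μ : Measure X) (B : ℕ → Set X) (h : ℕ → ℕ) : Prop :=
  ∀ A : Set X, MeasurableSet A → μ A < ⊤ → ∀ ε : ENNReal, 0 < ε →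
    ∃ N : ℕ, ∀ n ≥ N, ∃ S : Finset ℕ, S ⊆ Finset.range (h n) ∧
      μ (symmDiff A (⋃ i ∈ S, img T i (B n))) < ε

/-- `T` is rank-one: some sequence of Rokhlin columns approximates every measurable set of
finite measure. -/
def IsRankOne (T : X ≃ᵐ X) (μ : Measure X) : Prop :=
  ∃ (B : ℕ → Set X) (h : ℕ → ℕ), (∀ n, IsColumn T (B n) (h n)) ∧ Approximates T μ B h

/-- A presentation of `T` by cutting and stacking. The column `C_n` has base `base n` and height
`height n`; it is cut into `cuts n` subcolumns, `spacers n k` spacers are put above the `k`-th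
subcolumn, and the results are stacked in order to form `C_(n+1)`. -/
structure CuttingStacking (T : X ≃ᵐ X) (μ : Measure X) where
  base : ℕ → Set X
  height : ℕ → ℕ
  cuts : ℕ → ℕ
  spacers : ℕ → ℕ → ℕ
  isColumn : ∀ n, IsColumn T (base n) (height n)
  /-- `C_0` consists of a single set of positive finite measure. -/
  height_zero : height 0 = 1
  base_zero_pos : 0 < μ (base 0)
  base_zero_lt_top : μ (base 0) < ⊤
  two_le_cuts : ∀ n, 2 ≤ cuts n
  height_succ : ∀ n, height (n + 1) = ∑ k ∈ Finset.range (cuts n), (height n + spacers n k)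
  /-- The bases of the subcolumns of `C_n` are the levels of `C_(n+1)` at the heights
  `∑_{k < i} (height n + spacers n k)`, for `i < cuts n`. -/
  base_eq : ∀ n, base n = ⋃ i ∈ Finset.range (cuts n),
    img T (∑ k ∈ Finset.range i, (height n + spacers n k)) (base (n + 1))
  approximates : Approximates T μ base height

namespace CuttingStacking

variable {T : X ≃ᵐ X} {μ : Measure X}

open Classical in
/-- `D(J, m)`: the heights in `C_m` of the levels of `C_m` contained in `J`. -/
noncomputable def descendants (C : CuttingStacking T μ) (J : Set X) (m : ℕ) : Finset ℕ :=
  (Finset.range (C.height m)).filter fun i => img T i (C.base m) ⊆ J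

/-- `M_m = max D(I, m)`, where `I` is the single level of `C_0`. -/
noncomputable def maxHeight (C : CuttingStacking T μ) (m : ℕ) : ℕ :=
  (C.descendants (C.base 0) m).sup id

end CuttingStacking

/-- The intrinsic weight `u_k(F) = μ(F ∩ T^k F) / μ(F)^2`. -/
noncomputable def weight (T : X ≃ᵐ X) (μ : Measure X) (F : Set X) (k : ℕ) : ℝ :=
  μ.real (F ∩ img T k F) / μ.real F ^ 2

/-- `a_n(F) = ∑_{k < n} u_k(F)`. -/
noncomputable def weightSum (T : X ≃ᵐ X) (μ : Measure X) (F : Set X) (n : ℕ) : ℝ :=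
  ∑ k ∈ Finset.range n, weight T μ F k

/-- `F` sweeps out: the forward images `T^i(F)`, `i ≥ 0`, cover almost every point. -/
def SweepsOut (T : X ≃ᵐ X) (μ : Measure X) (F : Set X) : Prop :=
  μ (⋃ i : ℕ, img T i F)ᶜ = 0

/-- `T` is subsequence weakly rationally ergodic along `n 0 < n 1 < …` with respect to `F`. -/
structure SubseqWeaklyRationallyErgodic (T : X ≃ᵐ X) (μ : Measure X) (n : ℕ → ℕ) (F : Set X) :
    Prop where
  strictMono : StrictMono n
  measurableSet : MeasurableSet F
  pos : 0 < μ F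
  lt_top : μ F < ⊤
  sweepsOut : SweepsOut T μ F
  tendsto : ∀ A B : Set X, MeasurableSet A → MeasurableSet B → A ⊆ F → B ⊆ F →
    Tendsto
      (fun i => 1 / weightSum T μ F (n i) * ∑ k ∈ Finset.range (n i), μ.real (A ∩ img T k B))
      atTop (𝓝 (μ.real A * μ.real B))

end RankOne

namespace RankOne

/-! ### Forward images and columns. -/

section Images

variable {X : Type*} [MeasurableSpace X] {T : X ≃ᵐ X} {μ : Measure X}

/-! Convergence. Write d_m for the number of levels of C_m inside I, and R_m for the sum of μ(I ∩
T^k I) over k ≤ M_m. Translating a set by a fixed power of T changes only boundedly many terms of an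
overlap sum, while R_m → ∞. Hence all pairs of levels of a fixed C_l inside I have asymptotically
the same share 1/d_l² of R_m (`tendsto_overlap_levels`), which is the claim for unions of such
levels. To pass to arbitrary A, B ⊆ I the error must be controlled uniformly in m, and this is where
M_m + 1 matters. The window is at most h_m, so each level of C_m is met at most once and a set P
contributes at most d_m μ(P) (`overlap_right_le`, `overlap_left_le`). The window is also long enough
to see every pair of levels in I in one of its two orders, so R_m ≥ d_m μ(I)/2
(`card_mul_le_overlap`). The relative error is therefore at most a constant times the measure of the
symmetric differences.

Existence. The columns of a rank-one sequence need not be nested. Given a column over E, the levels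
of a late column lying mostly in E are spaced by at least its height, so they are the bases of
subcolumns once the levels below the lowest of them are removed. The removed part is small on sets
of finite measure: its backward translates almost miss E, whereas the forward images of E cover the
space (`Approximates.sweepsOut`). Iterating `Approximates.exists_refinement` gives columns nested up
to summable errors, and a limit makes the nesting exact (`exists_exact_columns`). -/

theorem mem_img {k : ℕ} {A : Set X} {x : X} : x ∈ img T k A ↔ (⇑T.symm)^[k] x ∈ A := by
  have hl : Function.LeftInverse (⇑T.symm)^[k] (⇑T)^[k] :=
    Function.LeftInverse.iterate T.symm_apply_apply k
  have hr : Function.RightInverse (⇑T.symm)^[k] (⇑T)^[k] :=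
    Function.LeftInverse.iterate T.apply_symm_apply k
  constructor
  · rintro ⟨y, hy, rfl⟩
    rwa [hl y]
  · intro h
    exact ⟨_, h, hr x⟩

theorem img_eq_preimage (k : ℕ) (A : Set X) : img T k A = (⇑T.symm)^[k] ⁻¹' A :=
  Set.ext fun _ => mem_img

@[simp] theorem img_zero (A : Set X) : img T 0 A = A := by simp [img]

theorem img_img (i j : ℕ) (A : Set X) : img T i (img T j A) = img T (i + j) A := by
  simp only [img, Function.iterate_add, Set.image_comp]

theorem img_inter (k : ℕ) (A B : Set X) : img T k (A ∩ B) = img T k A ∩ img T k B := by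
  simp only [img_eq_preimage, Set.preimage_inter]

theorem img_symmDiff (k : ℕ) (A B : Set X) :
    img T k (symmDiff A B) = symmDiff (img T k A) (img T k B) := by
  ext x; simp only [Set.mem_symmDiff, mem_img]

theorem img_iUnion {ι : Sort*} (k : ℕ) (A : ι → Set X) :
    img T k (⋃ i, A i) = ⋃ i, img T k (A i) := by
  simp only [img, Set.image_iUnion]

theorem img_mono (k : ℕ) {A B : Set X} (h : A ⊆ B) : img T k A ⊆ img T k B :=
  Set.image_mono h

theorem img_disjoint_iff {k : ℕ} {A B : Set X} :
    Disjoint (img T k A) (img T k B) ↔ Disjoint A B :=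
  Set.disjoint_image_iff (T.injective.iterate k)

theorem measurableSet_img (k : ℕ) {A : Set X} (hA : MeasurableSet A) :
    MeasurableSet (img T k A) := by
  rw [img_eq_preimage]
  exact (T.symm.measurable.iterate k) hA

theorem measure_img (hT : MeasurePreserving T μ μ) (k : ℕ) (A : Set X) :
    μ (img T k A) = μ A := by
  induction k with
  | zero => simp
  | succ k ih =>
    rw [add_comm, ← img_img, ← ih]
    have h : img T 1 (img T k A) = T.symm ⁻¹' (img T k A) := img_eq_preimage _ _
    rw [h]
    exact (MeasurePreserving.symm T hT).measure_preimage_equiv _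

theorem measureReal_img (hT : MeasurePreserving T μ μ) (k : ℕ) (A : Set X) :
    μ.real (img T k A) = μ.real A := by
  simp only [Measure.real, measure_img hT]

/-- Two levels within a column of height `h` are disjoint after a common translation. -/
theorem IsColumn.disjoint_img {B : Set X} {h : ℕ} (hB : IsColumn T B h) {i j : ℕ}
    (hij : i < j) (hj : j < i + h) : Disjoint (img T i B) (img T j B) := by
  obtain ⟨c, rfl⟩ := Nat.exists_eq_add_of_lt hij
  have := hB.disjoint_levels 0 hB.height_pos (c + 1) (by omega) (by omega)
  rw [← img_disjoint_iff (T := T) (k := i), img_img, img_img, add_zero] at this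
  rwa [add_assoc]

theorem IsColumn.pairwiseDisjoint {B : Set X} {h : ℕ} (hB : IsColumn T B h) {S : Set ℕ} {c : ℕ}
    (hS : ∀ i ∈ S, c ≤ i ∧ i < c + h) : S.PairwiseDisjoint fun i => img T i B := by
  intro i hi j hj hne
  have h1 := hS i hi
  have h2 := hS j hj
  rcases lt_or_gt_of_ne hne with h | h
  · exact hB.disjoint_img h (by omega)
  · exact (hB.disjoint_img h (by omega)).symm

theorem IsColumn.measurableSet_iUnion {B : Set X} {h : ℕ} (hB : IsColumn T B h) (S : Finset ℕ) :
    MeasurableSet (⋃ i ∈ S, img T i B) :=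
  S.measurableSet_biUnion fun _ _ => measurableSet_img _ hB.measurable_base

end Images

/-! ### Overlap sums: translation, continuity and upper bounds. -/

section Overlaps

variable {X : Type*} [MeasurableSpace X] {T : X ≃ᵐ X} {μ : Measure X}

/-- The total overlap `∑_{k < n} μ(A ∩ T^k B)`. -/
noncomputable def overlap (T : X ≃ᵐ X) (μ : Measure X) (n : ℕ) (A B : Set X) : ℝ :=
  ∑ k ∈ Finset.range n, μ.real (A ∩ img T k B)

theorem overlap_nonneg (n : ℕ) (A B : Set X) : 0 ≤ overlap T μ n A B :=
  Finset.sum_nonneg fun _ _ => measureReal_nonneg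

theorem overlap_iUnion {n : ℕ} {ι κ : Type*} (S : Finset ι) (S' : Finset κ) (A : ι → Set X)
    (B : κ → Set X) (hA : ∀ i, MeasurableSet (A i)) (hB : ∀ i, MeasurableSet (B i))
    (hAf : ∀ i, μ (A i) ≠ ⊤)
    (hAd : (S : Set ι).PairwiseDisjoint A) (hBd : (S' : Set κ).PairwiseDisjoint B) :
    overlap T μ n (⋃ i ∈ S, A i) (⋃ j ∈ S', B j) =
      ∑ i ∈ S, ∑ j ∈ S', overlap T μ n (A i) (B j) := by
  have h1 : ∀ k, μ.real ((⋃ i ∈ S, A i) ∩ img T k (⋃ j ∈ S', B j)) =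
      ∑ i ∈ S, ∑ j ∈ S', μ.real (A i ∩ img T k (B j)) := by
    intro k
    have e1 : (⋃ i ∈ S, A i) ∩ img T k (⋃ j ∈ S', B j) =
        ⋃ i ∈ S, (A i ∩ img T k (⋃ j ∈ S', B j)) := by
      simp only [Set.iUnion_inter]
    rw [e1, measureReal_biUnion_finset
      (fun i hi j hj hij => (hAd hi hj hij).mono Set.inter_subset_left Set.inter_subset_left)
      (fun i _ => (hA i).inter (measurableSet_img k (S'.measurableSet_biUnion fun j _ => hB j)))
      (fun i _ => measure_ne_top_of_subset Set.inter_subset_left (hAf i))]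
    refine Finset.sum_congr rfl fun i _ => ?_
    have e2 : A i ∩ img T k (⋃ j ∈ S', B j) = ⋃ j ∈ S', (A i ∩ img T k (B j)) := by
      simp only [img_iUnion, Set.inter_iUnion]
    rw [e2, measureReal_biUnion_finset
      (fun a ha b hb hab => (img_disjoint_iff.2 (hBd ha hb hab)).mono Set.inter_subset_right
        Set.inter_subset_right)
      (fun j _ => (hA i).inter (measurableSet_img k (hB j)))
      (fun j _ => measure_ne_top_of_subset Set.inter_subset_left (hAf i))]
  simp only [overlap, h1]
  rw [Finset.sum_comm]
  exact Finset.sum_congr rfl fun i _ => Finset.sum_comm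

/-- Moving A by one step shifts the summation index by one, so the two sums differ only by an end
term each, and both end terms lie in [0, μ(A)]. -/
theorem abs_overlap_img_left_sub_le (hT : MeasurePreserving T μ μ) (n a : ℕ) {A B : Set X}
    (hA : μ A ≠ ⊤) :
    |overlap T μ n (img T a A) B - overlap T μ n A B| ≤ a * μ.real A := by
  induction a with
  | zero => simp
  | succ a ih =>
    set A' := img T a A with hA'
    have hr : μ.real A' = μ.real A := measureReal_img hT a A
    have hf : μ (img T (1 + a) A) ≠ ⊤ := by rwa [measure_img hT]
    have key : overlap T μ n (img T (1 + a) A) B + μ.real (img T (1 + a) A ∩ img T n B) =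
        overlap T μ n A' B + μ.real (img T (1 + a) A ∩ img T 0 B) := by
      have h2 : ∀ k, μ.real (img T (1 + a) A ∩ img T (k + 1) B) = μ.real (A' ∩ img T k B) := by
        intro k
        rw [hA', ← measureReal_img hT 1 (img T a A ∩ img T k B), img_inter, img_img, img_img,
          add_comm k 1]
      unfold overlap
      rw [← Finset.sum_range_succ (fun k => μ.real (img T (1 + a) A ∩ img T k B)),
        Finset.sum_range_succ']
      simp only [h2]
    have b1 : μ.real (img T (1 + a) A ∩ img T n B) ≤ μ.real A := by
      rw [← measureReal_img hT (1 + a) A]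
      exact measureReal_mono Set.inter_subset_left hf
    have b2 : μ.real (img T (1 + a) A ∩ img T 0 B) ≤ μ.real A := by
      rw [← measureReal_img hT (1 + a) A]
      exact measureReal_mono Set.inter_subset_left hf
    have b3 : 0 ≤ μ.real (img T (1 + a) A ∩ img T n B) := measureReal_nonneg
    have b4 : 0 ≤ μ.real (img T (1 + a) A ∩ img T 0 B) := measureReal_nonneg
    rw [add_comm a 1]
    push_cast
    rw [abs_le] at ih ⊢
    constructor <;> linarith [ih.1, ih.2]

theorem abs_overlap_img_right_sub_le (n b : ℕ) {A B : Set X} (hA : μ A ≠ ⊤) :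
    |overlap T μ n A (img T b B) - overlap T μ n A B| ≤ b * μ.real A := by
  induction b with
  | zero => simp
  | succ b ih =>
    have key : overlap T μ n A (img T (b + 1) B) + μ.real (A ∩ img T 0 (img T b B)) =
        overlap T μ n A (img T b B) + μ.real (A ∩ img T n (img T b B)) := by
      have h2 : ∀ k, μ.real (A ∩ img T k (img T (b + 1) B)) =
          μ.real (A ∩ img T (k + 1) (img T b B)) := by
        intro k
        rw [img_img, img_img, add_comm b 1, add_assoc]
      unfold overlap
      rw [← Finset.sum_range_succ (fun k => μ.real (A ∩ img T k (img T b B))),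
        Finset.sum_range_succ']
      simp only [h2]
    have b1 : μ.real (A ∩ img T 0 (img T b B)) ≤ μ.real A :=
      measureReal_mono Set.inter_subset_left hA
    have b2 : μ.real (A ∩ img T n (img T b B)) ≤ μ.real A :=
      measureReal_mono Set.inter_subset_left hA
    have b3 : 0 ≤ μ.real (A ∩ img T 0 (img T b B)) := measureReal_nonneg
    have b4 : 0 ≤ μ.real (A ∩ img T n (img T b B)) := measureReal_nonneg
    push_cast
    rw [abs_le] at ih ⊢
    constructor <;> linarith [ih.1, ih.2]

theorem abs_overlap_sub_le {n : ℕ} {I A A' B B' : Set X}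
    (hI : μ I ≠ ⊤) (hA : A ⊆ I) (hA' : A' ⊆ I) (hB : B ⊆ I) (hB' : B' ⊆ I) :
    |overlap T μ n A B - overlap T μ n A' B'| ≤
      overlap T μ n (symmDiff A A') I + overlap T μ n I (symmDiff B B') := by
  have key : ∀ {A A' B B' : Set X}, A ⊆ I → A' ⊆ I → B ⊆ I → B' ⊆ I →
      overlap T μ n A B ≤ overlap T μ n A' B' +
        (overlap T μ n (symmDiff A A') I + overlap T μ n I (symmDiff B B')) := by
    intro A A' B B' hA hA' hB hB'
    unfold overlap
    rw [← Finset.sum_add_distrib, ← Finset.sum_add_distrib]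
    refine Finset.sum_le_sum fun k _ => ?_
    have hs : A ∩ img T k B ⊆ (A' ∩ img T k B') ∪
        ((symmDiff A A' ∩ img T k I) ∪ (I ∩ img T k (symmDiff B B'))) := by
      rintro x ⟨hx, hx'⟩
      have hx2 := img_mono k hB hx'
      simp only [Set.mem_union, Set.mem_inter_iff, Set.mem_symmDiff, mem_img] at hx' hx2 ⊢
      have := hA hx
      tauto
    have hsub : (A' ∩ img T k B') ∪
        ((symmDiff A A' ∩ img T k I) ∪ (I ∩ img T k (symmDiff B B'))) ⊆ I := by
      rintro x (hx | hx | hx)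
      · exact hA' hx.1
      · rcases hx.1 with h | h
        · exact hA h.1
        · exact hA' h.1
      · exact hx.1
    refine (measureReal_mono hs (measure_ne_top_of_subset hsub hI)).trans ?_
    refine (measureReal_union_le _ _).trans ?_
    gcongr
    exact measureReal_union_le _ _
  have h1 := key hA hA' hB hB'
  have h2 := key hA' hA hB' hB
  rw [symmDiff_comm A', symmDiff_comm B'] at h2
  rw [abs_le]
  constructor <;> linarith

/-- Within a time window no longer than the height of a column, each level is visited at most
once. -/
theorem overlap_levels_right_le {L : Set X} {h : ℕ} (hL : IsColumn T L h)
    {n : ℕ} (hn : n ≤ h) {A : Set X} (hA : MeasurableSet A) (hAf : μ A ≠ ⊤) (b : ℕ) :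
    overlap T μ n A (img T b L) ≤ μ.real A := by
  unfold overlap
  simp only [img_img]
  have hd : ((Finset.range n : Finset ℕ) : Set ℕ).PairwiseDisjoint
      fun k => A ∩ img T (k + b) L := by
    intro i hi j hj hij
    simp only [Finset.coe_range, Set.mem_Iio] at hi hj
    refine Disjoint.mono Set.inter_subset_right Set.inter_subset_right ?_
    rcases lt_or_gt_of_ne hij with h' | h'
    · exact hL.disjoint_img (by omega) (by omega)
    · exact (hL.disjoint_img (by omega) (by omega)).symm
  rw [← measureReal_biUnion_finset hd
    (fun i _ => hA.inter (measurableSet_img _ hL.measurable_base))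
    (fun i _ => measure_ne_top_of_subset Set.inter_subset_left hAf)]
  exact measureReal_mono (Set.iUnion₂_subset fun i _ => Set.inter_subset_left) hAf

/-- Applying T^(h-k) to the k-th term puts every intersection inside the single set T^h B, where the
translates of the level are disjoint. The exponent h - k keeps all images forward. -/
theorem overlap_levels_left_le (hT : MeasurePreserving T μ μ) {L : Set X} {h : ℕ}
    (hL : IsColumn T L h) {n : ℕ} (hn : n ≤ h) {B : Set X} (hB : MeasurableSet B)
    (hBf : μ B ≠ ⊤) (a : ℕ) :
    overlap T μ n (img T a L) B ≤ μ.real B := by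
  have hd : ((Finset.range n : Finset ℕ) : Set ℕ).PairwiseDisjoint
      fun k => img T (h - k + a) L ∩ img T h B := by
    intro i hi j hj hij
    simp only [Finset.coe_range, Set.mem_Iio] at hi hj
    refine Disjoint.mono Set.inter_subset_left Set.inter_subset_left ?_
    rcases lt_or_gt_of_ne hij with h' | h'
    · exact (hL.disjoint_img (by omega) (by omega)).symm
    · exact hL.disjoint_img (by omega) (by omega)
  have hf : μ (img T h B) ≠ ⊤ := by rwa [measure_img hT]
  have e : overlap T μ n (img T a L) B =
      ∑ k ∈ Finset.range n, μ.real (img T (h - k + a) L ∩ img T h B) := by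
    refine Finset.sum_congr rfl fun k hk => ?_
    rw [Finset.mem_range] at hk
    rw [← measureReal_img hT (h - k), img_inter, img_img, img_img,
      Nat.sub_add_cancel (by omega : k ≤ h)]
  rw [e, ← measureReal_biUnion_finset hd
    (fun i _ => (measurableSet_img _ hL.measurable_base).inter (measurableSet_img _ hB))
    (fun i _ => measure_ne_top_of_subset Set.inter_subset_right hf), ← measureReal_img hT h B]
  exact measureReal_mono (Set.iUnion₂_subset fun i _ => Set.inter_subset_right) hf

end Overlaps

/-! ### Weak rational ergodicity of a given presentation. -/

namespace CuttingStacking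

variable {X : Type*} [MeasurableSpace X] {T : X ≃ᵐ X} {μ : Measure X}

theorem base_subset (C : CuttingStacking T μ) (m : ℕ) : C.base m ⊆ C.base 0 := by
  induction m with
  | zero => exact subset_rfl
  | succ m ih =>
    refine Set.Subset.trans ?_ ih
    intro x hx
    rw [C.base_eq m]
    simp only [Set.mem_iUnion, Finset.mem_range]
    exact ⟨0, by have := C.two_le_cuts m; omega, by simpa using hx⟩

theorem offset_add_le (C : CuttingStacking T μ) (m : ℕ) {i : ℕ} (hi : i < C.cuts m) :
    ∑ k ∈ Finset.range i, (C.height m + C.spacers m k) + C.height m ≤ C.height (m + 1) := by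
  rw [C.height_succ]
  calc _ ≤ ∑ k ∈ Finset.range (i + 1), (C.height m + C.spacers m k) := by
        rw [Finset.sum_range_succ]; omega
    _ ≤ _ := Finset.sum_le_sum_of_subset (Finset.range_mono hi)

theorem exists_base_zero_eq (C : CuttingStacking T μ) (m : ℕ) :
    ∃ S : Finset ℕ, S ⊆ Finset.range (C.height m) ∧ C.base 0 = ⋃ i ∈ S, img T i (C.base m) := by
  classical
  induction m with
  | zero => exact ⟨{0}, by simp [C.height_zero], by simp⟩
  | succ m ih =>
    obtain ⟨S, hS, hI⟩ := ih
    refine ⟨S.biUnion fun i => (Finset.range (C.cuts m)).image fun l =>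
      i + ∑ k ∈ Finset.range l, (C.height m + C.spacers m k), ?_, ?_⟩
    · intro j hj
      simp only [Finset.mem_biUnion, Finset.mem_image, Finset.mem_range] at hj ⊢
      obtain ⟨i, hi, l, hl, rfl⟩ := hj
      have := C.offset_add_le m hl
      have := Finset.mem_range.1 (hS hi)
      omega
    · rw [hI]
      ext x
      rw [C.base_eq m]
      simp only [img_iUnion, img_img, Set.mem_iUnion, Finset.mem_biUnion, Finset.mem_image]
      constructor
      · rintro ⟨i, hi, l, hl, hx⟩
        exact ⟨_, ⟨i, hi, l, hl, rfl⟩, hx⟩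
      · rintro ⟨_, ⟨i, hi, l, hl, rfl⟩, hx⟩
        exact ⟨i, hi, l, hl, hx⟩

theorem measure_base_ne_top (C : CuttingStacking T μ) (m : ℕ) : μ (C.base m) ≠ ⊤ :=
  measure_ne_top_of_subset (C.base_subset m) C.base_zero_lt_top.ne

theorem measure_base_pos (C : CuttingStacking T μ) (hT : MeasurePreserving T μ μ) (m : ℕ) :
    0 < μ (C.base m) := by
  obtain ⟨S, -, hI⟩ := C.exists_base_zero_eq m
  by_contra h
  have h0 : μ (C.base m) = 0 := by simpa using h
  have : μ (C.base 0) = 0 := by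
    rw [hI]
    refine (measure_biUnion_null_iff S.countable_toSet).2 fun i _ => ?_
    rw [measure_img hT, h0]
  exact C.base_zero_pos.ne' this

theorem mem_descendants {C : CuttingStacking T μ} {J : Set X} {m i : ℕ} :
    i ∈ C.descendants J m ↔ i < C.height m ∧ img T i (C.base m) ⊆ J := by
  simp [descendants]

/-- Levels have positive measure, hence are nonempty, and they are disjoint; so a level contained in
I must be one of those whose union is I. -/
theorem base_zero_eq (C : CuttingStacking T μ) (hT : MeasurePreserving T μ μ) (m : ℕ) :
    C.base 0 = ⋃ i ∈ C.descendants (C.base 0) m, img T i (C.base m) := by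
  obtain ⟨S, hS, hI⟩ := C.exists_base_zero_eq m
  suffices C.descendants (C.base 0) m = S by rw [this]; exact hI
  ext i
  rw [mem_descendants]
  constructor
  · rintro ⟨hi, hsub⟩
    by_contra hiS
    have hne : (img T i (C.base m)).Nonempty :=
      nonempty_of_measure_ne_zero (by rw [measure_img hT]; exact (C.measure_base_pos hT m).ne')
    obtain ⟨x, hx⟩ := hne
    have hx' := hsub hx
    rw [hI] at hx'
    simp only [Set.mem_iUnion] at hx'
    obtain ⟨j, hj, hxj⟩ := hx'
    refine Set.disjoint_left.1 ((C.isColumn m).disjoint_levels i hi j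
      (Finset.mem_range.1 (hS hj)) ?_) hx hxj
    rintro rfl
    exact hiS hj
  · intro hi
    refine ⟨Finset.mem_range.1 (hS hi), ?_⟩
    intro x hx
    rw [hI]
    exact Set.mem_biUnion hi hx

theorem zero_mem_descendants (C : CuttingStacking T μ) (m : ℕ) :
    0 ∈ C.descendants (C.base 0) m :=
  mem_descendants.2 ⟨(C.isColumn m).height_pos, by simpa using C.base_subset m⟩

theorem maxHeight_mem (C : CuttingStacking T μ) (m : ℕ) :
    C.maxHeight m ∈ C.descendants (C.base 0) m := by
  obtain ⟨i, hi, h⟩ := Finset.exists_mem_eq_sup _ ⟨0, C.zero_mem_descendants m⟩ id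
  rw [maxHeight, h]
  exact hi

theorem le_maxHeight {C : CuttingStacking T μ} {m i : ℕ}
    (hi : i ∈ C.descendants (C.base 0) m) : i ≤ C.maxHeight m :=
  Finset.le_sup (f := id) hi

theorem maxHeight_lt (C : CuttingStacking T μ) (m : ℕ) : C.maxHeight m < C.height m :=
  (mem_descendants.1 (C.maxHeight_mem m)).1

theorem maxHeight_lt_succ (C : CuttingStacking T μ) (m : ℕ) :
    C.maxHeight m < C.maxHeight (m + 1) := by
  have h1 := mem_descendants.1 (C.maxHeight_mem m)
  have h2 := C.offset_add_le m (i := 1) (by have := C.two_le_cuts m; omega)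
  rw [Finset.sum_range_one] at h2
  have hpos := (C.isColumn m).height_pos
  -- The second copy of C_m in C_(m+1) begins at height h_m + s_(m,0) and contains a copy of the top
  -- level in I.
  have h3 : C.maxHeight m + (C.height m + C.spacers m 0) ∈ C.descendants (C.base 0) (m + 1) := by
    refine mem_descendants.2 ⟨by omega, ?_⟩
    rw [← img_img]
    refine (img_mono _ ?_).trans h1.2
    intro x hx
    rw [C.base_eq m]
    simp only [Set.mem_iUnion, Finset.mem_range]
    exact ⟨1, by have := C.two_le_cuts m; omega, by simpa using hx⟩
  have := le_maxHeight h3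
  omega

theorem pairwiseDisjoint_descendants (C : CuttingStacking T μ) (J : Set X) (m : ℕ) :
    ((C.descendants J m : Finset ℕ) : Set ℕ).PairwiseDisjoint fun i => img T i (C.base m) :=
  (C.isColumn m).pairwiseDisjoint (c := 0) fun i hi => by
    have := (mem_descendants.1 (Finset.mem_coe.1 hi)).1
    omega

theorem card_mul_measureReal (C : CuttingStacking T μ) (hT : MeasurePreserving T μ μ) (m : ℕ) :
    ((C.descendants (C.base 0) m).card : ℝ) * μ.real (C.base m) = μ.real (C.base 0) := by
  conv_rhs => rw [C.base_zero_eq hT m]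
  rw [measureReal_biUnion_finset (C.pairwiseDisjoint_descendants _ m)
    (fun i _ => measurableSet_img _ (C.isColumn m).measurable_base)
    (fun i _ => by rw [measure_img hT]; exact C.measure_base_ne_top m)]
  simp [measureReal_img hT]

theorem two_mul_measureReal_base_succ_le (C : CuttingStacking T μ) (hT : MeasurePreserving T μ μ)
    (m : ℕ) : 2 * μ.real (C.base (m + 1)) ≤ μ.real (C.base m) := by
  have hr := C.two_le_cuts m
  have h2 := C.offset_add_le m (i := 1) (by omega)
  rw [Finset.sum_range_one] at h2
  have hpos := (C.isColumn m).height_pos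
  have hd := (C.isColumn (m + 1)).disjoint_levels 0 (by omega)
    (C.height m + C.spacers m 0) (by omega) (by omega)
  have hsub : img T 0 (C.base (m + 1)) ∪ img T (C.height m + C.spacers m 0) (C.base (m + 1)) ⊆
      C.base m := by
    intro x hx
    rw [C.base_eq m]
    simp only [Set.mem_iUnion, Finset.mem_range]
    rcases hx with hx | hx
    · exact ⟨0, by omega, by simpa using hx⟩
    · exact ⟨1, by omega, by simpa using hx⟩
  have h := measureReal_mono hsub (C.measure_base_ne_top m)
  rw [measureReal_union hd (measurableSet_img _ (C.isColumn (m + 1)).measurable_base)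
    (by rw [measure_img hT]; exact C.measure_base_ne_top _)
    (by rw [measure_img hT]; exact C.measure_base_ne_top _), measureReal_img hT,
    measureReal_img hT] at h
  linarith

theorem measureReal_base_pos (C : CuttingStacking T μ) (hT : MeasurePreserving T μ μ) (m : ℕ) :
    0 < μ.real (C.base m) :=
  ENNReal.toReal_pos (C.measure_base_pos hT m).ne' (C.measure_base_ne_top m)

theorem tendsto_card_descendants (C : CuttingStacking T μ) (hT : MeasurePreserving T μ μ) :
    Tendsto (fun m => ((C.descendants (C.base 0) m).card : ℝ)) atTop atTop := by
  have h1 : ∀ m, (2 : ℝ) ^ m * μ.real (C.base m) ≤ μ.real (C.base 0) := by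
    intro m
    induction m with
    | zero => simp
    | succ m ih =>
      calc (2 : ℝ) ^ (m + 1) * μ.real (C.base (m + 1))
          = 2 ^ m * (2 * μ.real (C.base (m + 1))) := by ring
        _ ≤ 2 ^ m * μ.real (C.base m) := by
          gcongr; exact C.two_mul_measureReal_base_succ_le hT m
        _ ≤ _ := ih
  refine tendsto_atTop_mono (fun m => ?_)
    (tendsto_pow_atTop_atTop_of_one_lt (one_lt_two : (1 : ℝ) < 2))
  have h2 := h1 m
  rw [← C.card_mul_measureReal hT m] at h2
  exact le_of_mul_le_mul_right h2 (C.measureReal_base_pos hT m)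

/-- Split I into its d_m levels; the window M_m + 1 ≤ h_m lets each of them contribute at most μ(A).
-/
theorem overlap_right_le (C : CuttingStacking T μ) (hT : MeasurePreserving T μ μ) (m : ℕ)
    {A : Set X} (hA : MeasurableSet A) (hAf : μ A ≠ ⊤) :
    overlap T μ (C.maxHeight m + 1) A (C.base 0) ≤
      (C.descendants (C.base 0) m).card * μ.real A := by
  have h := overlap_iUnion (T := T) (μ := μ) (n := C.maxHeight m + 1) ({()} : Finset Unit)
    (C.descendants (C.base 0) m) (fun _ => A) (fun i => img T i (C.base m)) (fun _ => hA)
    (fun i => measurableSet_img _ (C.isColumn m).measurable_base) (fun _ => hAf)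
    (by simp) (C.pairwiseDisjoint_descendants _ m)
  simp only [Finset.set_biUnion_singleton, Finset.sum_singleton,
    ← C.base_zero_eq hT m] at h
  rw [h, ← nsmul_eq_mul]
  exact Finset.sum_le_card_nsmul _ _ _ fun i _ =>
    overlap_levels_right_le (C.isColumn m) (C.maxHeight_lt m) hA hAf i

theorem overlap_left_le (C : CuttingStacking T μ) (hT : MeasurePreserving T μ μ) (m : ℕ)
    {B : Set X} (hB : MeasurableSet B) (hBf : μ B ≠ ⊤) :
    overlap T μ (C.maxHeight m + 1) (C.base 0) B ≤
      (C.descendants (C.base 0) m).card * μ.real B := by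
  have h := overlap_iUnion (T := T) (μ := μ) (n := C.maxHeight m + 1)
    (C.descendants (C.base 0) m) ({()} : Finset Unit) (fun i => img T i (C.base m)) (fun _ => B)
    (fun i => measurableSet_img _ (C.isColumn m).measurable_base) (fun _ => hB)
    (fun i => by rw [measure_img hT]; exact C.measure_base_ne_top m)
    (C.pairwiseDisjoint_descendants _ m) (by simp)
  simp only [Finset.set_biUnion_singleton, Finset.sum_singleton,
    ← C.base_zero_eq hT m] at h
  rw [h, ← nsmul_eq_mul]
  exact Finset.sum_le_card_nsmul _ _ _ fun i _ =>
    overlap_levels_left_le hT (C.isColumn m) (C.maxHeight_lt m) hB hBf i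

/-- At least half of the pairs of descendants of the base level contribute to its overlap. -/
theorem card_mul_le_overlap (C : CuttingStacking T μ) (hT : MeasurePreserving T μ μ) (m : ℕ) :
    (C.descendants (C.base 0) m).card * μ.real (C.base 0) ≤
      2 * overlap T μ (C.maxHeight m + 1) (C.base 0) (C.base 0) := by
  set D := C.descendants (C.base 0) m with hD
  set v := μ.real (C.base m) with hv
  have hmeas : ∀ i, MeasurableSet (img T i (C.base m)) := fun i =>
    measurableSet_img _ (C.isColumn m).measurable_base
  have hfin : ∀ i, μ (img T i (C.base m)) ≠ ⊤ := fun i => by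
    rw [measure_img hT]; exact C.measure_base_ne_top m
  have h := overlap_iUnion (T := T) (μ := μ) (n := C.maxHeight m + 1) D D
    (fun i => img T i (C.base m)) (fun i => img T i (C.base m)) hmeas hmeas hfin
    (C.pairwiseDisjoint_descendants _ m) (C.pairwiseDisjoint_descendants _ m)
  rw [hD, ← C.base_zero_eq hT m, ← hD] at h
  have h1 : ∀ a ∈ D, ∀ b ∈ D, (if b ≤ a then v else 0) ≤
      overlap T μ (C.maxHeight m + 1) (img T a (C.base m)) (img T b (C.base m)) := by
    intro a ha b _
    split_ifs with hab
    · have hle := le_maxHeight ha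
      unfold overlap
      -- The single term k = a - b, which is in the window because a ≤ M_m, already carries a whole
      -- level.
      refine le_trans (le_of_eq ?_) (Finset.single_le_sum (fun _ _ => measureReal_nonneg)
        (Finset.mem_range.2 (by omega : a - b < C.maxHeight m + 1)))
      rw [img_img, Nat.sub_add_cancel hab, Set.inter_self, measureReal_img hT]
    · exact overlap_nonneg _ _ _
  have h2 : ∑ a ∈ D, ∑ b ∈ D, (if b ≤ a then v else 0) ≤
      overlap T μ (C.maxHeight m + 1) (C.base 0) (C.base 0) := by
    rw [h]
    exact Finset.sum_le_sum fun a ha => Finset.sum_le_sum fun b hb => h1 a ha b hb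
  -- Every pair satisfies b ≤ a or a ≤ b, and the two sums agree by symmetry; hence the factor 2.
  have h3 : ∑ a ∈ D, ∑ b ∈ D, v ≤
      (∑ a ∈ D, ∑ b ∈ D, (if b ≤ a then v else 0)) +
        ∑ a ∈ D, ∑ b ∈ D, (if a ≤ b then v else 0) := by
    rw [← Finset.sum_add_distrib]
    refine Finset.sum_le_sum fun a _ => ?_
    rw [← Finset.sum_add_distrib]
    refine Finset.sum_le_sum fun b _ => ?_
    have hv0 : 0 ≤ v := measureReal_nonneg
    rcases le_total a b with hab | hab <;> simp only [hab, if_true] <;> split_ifs <;> linarith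
  rw [Finset.sum_comm (f := fun a b => if a ≤ b then v else 0)] at h3
  simp only [Finset.sum_const, nsmul_eq_mul] at h3
  have h4 : (D.card : ℝ) * v = μ.real (C.base 0) := C.card_mul_measureReal hT m
  rw [h4] at h3
  linarith

theorem sweepsOut_base_zero [SigmaFinite μ] (C : CuttingStacking T μ) :
    SweepsOut T μ (C.base 0) := by
  unfold SweepsOut
  set U := ⋃ i : ℕ, img T i (C.base 0) with hU
  have hUm : MeasurableSet U :=
    MeasurableSet.iUnion fun i => measurableSet_img _ (C.isColumn 0).measurable_base
  by_contra hne
  obtain ⟨A, hAm, hAU, hA0, hAf⟩ :=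
    Measure.exists_subset_measure_lt_top hUm.compl (pos_iff_ne_zero.2 hne)
  -- Every level of every column lies in a forward image of I, so A misses all of them and no union
  -- of levels can be closer to A than μ(A).
  obtain ⟨N, hN⟩ := C.approximates A hAm hAf (μ A) hA0
  obtain ⟨S, -, hS⟩ := hN N le_rfl
  refine hS.not_ge (measure_mono fun x hx => Or.inl ⟨hx, fun hxS => hAU hx ?_⟩)
  simp only [Set.mem_iUnion] at hxS
  obtain ⟨i, -, hi⟩ := hxS
  exact Set.mem_iUnion.2 ⟨i, img_mono i (C.base_subset N) hi⟩

theorem overlap_base_zero_pos (C : CuttingStacking T μ) (hT : MeasurePreserving T μ μ) (m : ℕ) :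
    0 < overlap T μ (C.maxHeight m + 1) (C.base 0) (C.base 0) := by
  have h := C.card_mul_le_overlap hT m
  have h1 : 0 < ((C.descendants (C.base 0) m).card : ℝ) := by
    exact_mod_cast Finset.card_pos.2 ⟨0, C.zero_mem_descendants m⟩
  have := mul_pos h1 (C.measureReal_base_pos hT 0)
  linarith

theorem tendsto_overlap_base_zero (C : CuttingStacking T μ) (hT : MeasurePreserving T μ μ) :
    Tendsto (fun m => overlap T μ (C.maxHeight m + 1) (C.base 0) (C.base 0)) atTop atTop := by
  have h := (C.tendsto_card_descendants hT).atTop_mul_const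
    (half_pos (C.measureReal_base_pos hT 0))
  refine tendsto_atTop_mono (fun m => ?_) h
  have := C.card_mul_le_overlap hT m
  linarith

/-- All pairs of levels of a given column inside the base level have the same asymptotic share of
the total overlap. -/
theorem tendsto_overlap_levels (C : CuttingStacking T μ) (hT : MeasurePreserving T μ μ)
    (l a b : ℕ) :
    Tendsto (fun m => overlap T μ (C.maxHeight m + 1) (img T a (C.base l)) (img T b (C.base l)) /
      overlap T μ (C.maxHeight m + 1) (C.base 0) (C.base 0)) atTop
      (𝓝 (1 / ((C.descendants (C.base 0) l).card : ℝ) ^ 2)) := by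
  set D := C.descendants (C.base 0) l with hD
  set L := C.base l with hL
  set R := fun m => overlap T μ (C.maxHeight m + 1) (C.base 0) (C.base 0) with hR
  set f := fun (a b m : ℕ) => overlap T μ (C.maxHeight m + 1) (img T a L) (img T b L) / R m with hf
  set c := fun m => overlap T μ (C.maxHeight m + 1) L L / R m with hc
  have hRpos : ∀ m, 0 < R m := C.overlap_base_zero_pos hT
  have hRt : Tendsto R atTop atTop := C.tendsto_overlap_base_zero hT
  have hfin : μ L ≠ ⊤ := C.measure_base_ne_top l
  have hmeas : ∀ i, MeasurableSet (img T i L) := fun i =>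
    measurableSet_img _ (C.isColumn l).measurable_base
  have hdiff : ∀ a b, Tendsto (fun m => f a b m - c m) atTop (𝓝 0) := by
    intro a b
    have hK : Tendsto (fun m => (a * μ.real L + b * μ.real L) / R m) atTop (𝓝 0) :=
      hRt.const_div_atTop _
    refine squeeze_zero_norm (fun m => ?_) hK
    have h1 := abs_overlap_img_left_sub_le hT (C.maxHeight m + 1) a (B := img T b L) hfin
    have h2 := abs_overlap_img_right_sub_le (T := T) (C.maxHeight m + 1) b (B := L) hfin
    rw [hf, hc, Real.norm_eq_abs, ← sub_div, abs_div, abs_of_pos (hRpos m)]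
    refine div_le_div_of_nonneg_right ?_ (hRpos m).le
    exact (abs_sub_le _ _ _).trans (add_le_add h1 h2)
  have hsum : ∀ m, ∑ a ∈ D, ∑ b ∈ D, f a b m = 1 := by
    intro m
    have h := overlap_iUnion (T := T) (μ := μ) (n := C.maxHeight m + 1) D D
      (fun i => img T i L) (fun i => img T i L) hmeas hmeas
      (fun i => by rwa [measure_img hT])
      (C.pairwiseDisjoint_descendants _ l) (C.pairwiseDisjoint_descendants _ l)
    rw [hD, ← C.base_zero_eq hT l, ← hD] at h
    simp only [hf, ← Finset.sum_div]
    rw [← h]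
    exact div_self (hRpos m).ne'
  have hd : (D.card : ℝ) ≠ 0 := by
    exact_mod_cast (Finset.card_pos.2 ⟨0, C.zero_mem_descendants l⟩).ne'
  have hS : Tendsto (fun m => ∑ a ∈ D, ∑ b ∈ D, (f a b m - c m)) atTop (𝓝 0) := by
    simpa using tendsto_finsetSum D fun a _ => tendsto_finsetSum D fun b _ => hdiff a b
  have hcl : Tendsto c atTop (𝓝 (1 / (D.card : ℝ) ^ 2)) := by
    -- The shares of all pairs sum to 1 and each differs from `c m` by o(1), which determines `c m`.
    have h3 : c = fun m => (1 - ∑ a ∈ D, ∑ b ∈ D, (f a b m - c m)) / (D.card : ℝ) ^ 2 := by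
      funext m
      simp only [Finset.sum_sub_distrib, hsum, Finset.sum_const, nsmul_eq_mul]
      field_simp
      ring
    rw [h3]
    simpa using (hS.const_sub 1).div_const ((D.card : ℝ) ^ 2)
  simpa using (hdiff a b).add hcl

theorem tendsto_overlap_unions (C : CuttingStacking T μ) (hT : MeasurePreserving T μ μ)
    (l : ℕ) {S S' : Finset ℕ} (hS : S ⊆ C.descendants (C.base 0) l)
    (hS' : S' ⊆ C.descendants (C.base 0) l) :
    Tendsto (fun m => overlap T μ (C.maxHeight m + 1) (⋃ i ∈ S, img T i (C.base l))
        (⋃ i ∈ S', img T i (C.base l)) /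
      overlap T μ (C.maxHeight m + 1) (C.base 0) (C.base 0)) atTop
      (𝓝 (μ.real (⋃ i ∈ S, img T i (C.base l)) * μ.real (⋃ i ∈ S', img T i (C.base l)) /
        μ.real (C.base 0) ^ 2)) := by
  set D := C.descendants (C.base 0) l with hD
  set L := C.base l with hL
  have hmeas : ∀ i, MeasurableSet (img T i L) := fun i =>
    measurableSet_img _ (C.isColumn l).measurable_base
  have hfin : ∀ i, μ (img T i L) ≠ ⊤ := fun i => by
    rw [measure_img hT]; exact C.measure_base_ne_top l
  have hdisj := C.pairwiseDisjoint_descendants (C.base 0) l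
  have hm : ∀ S ⊆ D, μ.real (⋃ i ∈ S, img T i L) = S.card * μ.real L := by
    intro S hS
    rw [measureReal_biUnion_finset (hdisj.subset (Finset.coe_subset.2 hS)) (fun i _ => hmeas i)
      (fun i _ => hfin i)]
    simp [measureReal_img hT, hL]
  have hlim : μ.real (⋃ i ∈ S, img T i L) * μ.real (⋃ i ∈ S', img T i L) / μ.real (C.base 0) ^ 2 =
      ∑ a ∈ S, ∑ b ∈ S', 1 / (D.card : ℝ) ^ 2 := by
    rw [hm S hS, hm S' hS', ← C.card_mul_measureReal hT l, ← hD, ← hL]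
    have hL0 : μ.real L ≠ 0 := (C.measureReal_base_pos hT l).ne'
    have hd : (D.card : ℝ) ≠ 0 := by
      exact_mod_cast (Finset.card_pos.2 ⟨0, C.zero_mem_descendants l⟩).ne'
    simp only [Finset.sum_const, nsmul_eq_mul]
    field_simp
  rw [hlim]
  have h := fun n => overlap_iUnion (T := T) (μ := μ) (n := n) S S'
      (fun i => img T i L) (fun i => img T i L) hmeas hmeas hfin
      (hdisj.subset (Finset.coe_subset.2 hS)) (hdisj.subset (Finset.coe_subset.2 hS'))
  simp only [h, Finset.sum_div]
  exact tendsto_finsetSum S fun a _ => tendsto_finsetSum S' fun b _ =>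
    C.tendsto_overlap_levels hT l a b

/-- Subsets of the base level are approximated by unions of its descendants. -/
theorem exists_descendants_approx (C : CuttingStacking T μ) (hT : MeasurePreserving T μ μ)
    {A : Set X} (hA : MeasurableSet A) (hAI : A ⊆ C.base 0) {ε : ℝ} (hε : 0 < ε) :
    ∃ N, ∀ n ≥ N, ∃ S ⊆ C.descendants (C.base 0) n,
      μ.real (symmDiff A (⋃ i ∈ S, img T i (C.base n))) < ε := by
  obtain ⟨N, hN⟩ := C.approximates A hA ((measure_mono hAI).trans_lt C.base_zero_lt_top)
    (ENNReal.ofReal ε) (ENNReal.ofReal_pos.2 hε)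
  refine ⟨N, fun n hn => ?_⟩
  obtain ⟨S, hS, h⟩ := hN n hn
  -- Since A ⊆ I and I is a union of whole levels, discarding the levels outside I cannot worsen the
  -- approximation.
  refine ⟨S ∩ C.descendants (C.base 0) n, Finset.inter_subset_right, ?_⟩
  have hlt : μ (symmDiff A (⋃ i ∈ S ∩ C.descendants (C.base 0) n, img T i (C.base n))) <
      ENNReal.ofReal ε := by
    refine lt_of_le_of_lt (measure_mono ?_) h
    rintro x (⟨hxA, hx⟩ | ⟨hx, hxA⟩)
    · refine Or.inl ⟨hxA, fun hxS => hx ?_⟩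
      have hxI := hAI hxA
      rw [C.base_zero_eq hT n] at hxI
      simp only [Set.mem_iUnion] at hxS hxI ⊢
      obtain ⟨i, hi, hxi⟩ := hxS
      obtain ⟨j, hj, hxj⟩ := hxI
      have hij : i = j := by
        by_contra hne
        exact Set.disjoint_left.1 ((C.isColumn n).disjoint_levels i (Finset.mem_range.1 (hS hi)) j
          (mem_descendants.1 hj).1 hne) hxi hxj
      subst hij
      exact ⟨i, Finset.mem_inter.2 ⟨hi, hj⟩, hxi⟩
    · refine Or.inr ⟨?_, hxA⟩
      simp only [Set.mem_iUnion] at hx ⊢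
      obtain ⟨i, hi, hxi⟩ := hx
      exact ⟨i, (Finset.mem_inter.1 hi).1, hxi⟩
  exact (ENNReal.toReal_lt_toReal hlt.ne_top ENNReal.ofReal_ne_top).2 hlt |>.trans_eq
    (ENNReal.toReal_ofReal hε.le)

/-- The approximating unions A', B' are fixed before m grows; this is legitimate because the ratio
depends on A and B continuously in measure, uniformly in m. -/
theorem tendsto_overlap (C : CuttingStacking T μ) (hT : MeasurePreserving T μ μ)
    {A B : Set X} (hA : MeasurableSet A) (hB : MeasurableSet B) (hAI : A ⊆ C.base 0)
    (hBI : B ⊆ C.base 0) :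
    Tendsto (fun m => overlap T μ (C.maxHeight m + 1) A B /
      overlap T μ (C.maxHeight m + 1) (C.base 0) (C.base 0)) atTop
      (𝓝 (μ.real A * μ.real B / μ.real (C.base 0) ^ 2)) := by
  set I := C.base 0 with hI
  have hIf : μ I ≠ ⊤ := C.measure_base_ne_top 0
  have hv : 0 < μ.real I := C.measureReal_base_pos hT 0
  rw [Metric.tendsto_atTop]
  intro ε hε
  -- From d_m μ(I) ≤ 2 R_m, the replacement error 2 d_m δ is at most R_m ε/2; the limits then differ
  -- by at most 2δ/μ(I) = ε/4, leaving ε/4 for the convergence for A', B'.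
  set δ := ε * μ.real I / 8 with hδ
  have hδ0 : 0 < δ := by positivity
  obtain ⟨N₁, hN₁⟩ := C.exists_descendants_approx hT hA hAI hδ0
  obtain ⟨N₂, hN₂⟩ := C.exists_descendants_approx hT hB hBI hδ0
  obtain ⟨S, hS, hAS⟩ := hN₁ (max N₁ N₂) (le_max_left _ _)
  obtain ⟨S', hS', hBS⟩ := hN₂ (max N₁ N₂) (le_max_right _ _)
  have hlim := C.tendsto_overlap_unions hT (max N₁ N₂) hS hS'
  have hsub : ∀ S ⊆ C.descendants I (max N₁ N₂), (⋃ i ∈ S, img T i (C.base (max N₁ N₂))) ⊆ I :=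
    fun S hS => Set.iUnion₂_subset fun i hi => (mem_descendants.1 (hS hi)).2
  have hA'I := hsub S hS
  have hB'I := hsub S' hS'
  have hA' : MeasurableSet (⋃ i ∈ S, img T i (C.base (max N₁ N₂))) :=
    (C.isColumn _).measurableSet_iUnion S
  have hB' : MeasurableSet (⋃ i ∈ S', img T i (C.base (max N₁ N₂))) :=
    (C.isColumn _).measurableSet_iUnion S'
  generalize (⋃ i ∈ S, img T i (C.base (max N₁ N₂))) = A' at *
  generalize (⋃ i ∈ S', img T i (C.base (max N₁ N₂))) = B' at *
  rw [Metric.tendsto_atTop] at hlim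
  obtain ⟨M, hM⟩ := hlim (ε / 4) (by positivity)
  refine ⟨M, fun m hm => ?_⟩
  have h1 := hM m hm
  rw [Real.dist_eq] at h1 ⊢
  have hR := C.overlap_base_zero_pos hT m
  have hb := C.card_mul_le_overlap hT m
  have hsf : ∀ {P Q : Set X}, P ⊆ I → Q ⊆ I → μ (symmDiff P Q) ≠ ⊤ := fun hP hQ =>
    measure_ne_top_of_subset (symmDiff_le_sup.trans (sup_le hP hQ)) hIf
  have hr := C.overlap_right_le hT m (hA.symmDiff hA') (hsf hAI hA'I)
  have hl := C.overlap_left_le hT m (hB.symmDiff hB') (hsf hBI hB'I)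
  have hab := abs_overlap_sub_le (T := T) (n := C.maxHeight m + 1) hIf hAI hA'I hBI hB'I
  rw [← hI] at hR hb hr hl
  set R := overlap T μ (C.maxHeight m + 1) I I with hRdef
  set d := ((C.descendants I m).card : ℝ) with hd
  have hd0 : 0 ≤ d := Nat.cast_nonneg _
  have h2 : |overlap T μ (C.maxHeight m + 1) A B / R - overlap T μ (C.maxHeight m + 1) A' B' / R| ≤
      ε / 2 := by
    rw [← sub_div, abs_div, abs_of_pos hR, div_le_iff₀ hR]
    have h3 : d * μ.real (symmDiff A A') ≤ d * δ := by gcongr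
    have h4 : d * μ.real (symmDiff B B') ≤ d * δ := by gcongr
    have h5 : d * δ = (d * μ.real I) * (ε / 8) := by rw [hδ]; ring
    have h6 : (d * μ.real I) * (ε / 8) ≤ 2 * R * (ε / 8) := by gcongr
    linarith
  have hmA : |μ.real A - μ.real A'| ≤ δ :=
    (abs_measureReal_sub_le_measureReal_symmDiff' hA.nullMeasurableSet hA'.nullMeasurableSet
      (measure_ne_top_of_subset hAI hIf) (measure_ne_top_of_subset hA'I hIf)).trans hAS.le
  have hmB : |μ.real B - μ.real B'| ≤ δ :=
    (abs_measureReal_sub_le_measureReal_symmDiff' hB.nullMeasurableSet hB'.nullMeasurableSet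
      (measure_ne_top_of_subset hBI hIf) (measure_ne_top_of_subset hB'I hIf)).trans hBS.le
  have hAle : μ.real A' ≤ μ.real I := measureReal_mono hA'I hIf
  have hBle : μ.real B ≤ μ.real I := measureReal_mono hBI hIf
  have h7 : |μ.real A' * μ.real B' / μ.real I ^ 2 - μ.real A * μ.real B / μ.real I ^ 2| ≤ ε / 4 := by
    rw [← sub_div, abs_div, abs_of_pos (by positivity : 0 < μ.real I ^ 2),
      div_le_iff₀ (by positivity)]
    have e : μ.real A' * μ.real B' - μ.real A * μ.real B =
        -(μ.real A' * (μ.real B - μ.real B')) - (μ.real A - μ.real A') * μ.real B := by ring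
    rw [e]
    calc _ ≤ |(-(μ.real A' * (μ.real B - μ.real B')))| + |(μ.real A - μ.real A') * μ.real B| :=
          abs_sub _ _
      _ = μ.real A' * |μ.real B - μ.real B'| + |μ.real A - μ.real A'| * μ.real B := by
          rw [abs_neg, abs_mul, abs_mul, abs_of_nonneg (measureReal_nonneg (s := A')),
            abs_of_nonneg (measureReal_nonneg (s := B))]
      _ ≤ μ.real I * δ + δ * μ.real I := by gcongr
      _ = ε / 4 * μ.real I ^ 2 := by rw [hδ]; ring
  have h8 := abs_sub_le (overlap T μ (C.maxHeight m + 1) A B / R)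
    (overlap T μ (C.maxHeight m + 1) A' B' / R) (μ.real A * μ.real B / μ.real I ^ 2)
  have h9 := abs_sub_le (overlap T μ (C.maxHeight m + 1) A' B' / R)
    (μ.real A' * μ.real B' / μ.real I ^ 2) (μ.real A * μ.real B / μ.real I ^ 2)
  linarith

theorem subseqWeaklyRationallyErgodic [SigmaFinite μ] (C : CuttingStacking T μ)
    (hT : MeasurePreserving T μ μ) :
    SubseqWeaklyRationallyErgodic T μ (fun m => C.maxHeight m + 1) (C.base 0) where
  strictMono := strictMono_nat_of_lt_succ fun m => Nat.succ_lt_succ (C.maxHeight_lt_succ m)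
  measurableSet := (C.isColumn 0).measurable_base
  pos := C.base_zero_pos
  lt_top := C.base_zero_lt_top
  sweepsOut := C.sweepsOut_base_zero
  tendsto A B hA hB hAI hBI := by
    have hv := (C.measureReal_base_pos hT 0).ne'
    have h := (C.tendsto_overlap hT hA hB hAI hBI).mul_const (μ.real (C.base 0) ^ 2)
    rw [div_mul_cancel₀ _ (pow_ne_zero 2 hv)] at h
    refine h.congr fun m => ?_
    have e : weightSum T μ (C.base 0) (C.maxHeight m + 1) =
        overlap T μ (C.maxHeight m + 1) (C.base 0) (C.base 0) / μ.real (C.base 0) ^ 2 := by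
      simp only [weightSum, weight, overlap, Finset.sum_div]
    rw [e, one_div_div]
    simp only [overlap]
    ring

end CuttingStacking

end RankOne

namespace RankOne

/-! ### Every set of positive measure sweeps out. -/

section Sweeping

variable {X : Type*} [MeasurableSpace X] {T : X ≃ᵐ X} {μ : Measure X}

theorem IsNonatomic.exists_measure_lt [SigmaFinite μ] (hna : IsNonatomic μ) (hμ : μ ≠ 0)
    {η : ENNReal} (hη : η ≠ 0) : ∃ A, MeasurableSet A ∧ 0 < μ A ∧ μ A < η := by
  obtain ⟨A₀, hA₀, -, hpos, hfin⟩ := Measure.exists_subset_measure_lt_top (μ := μ) (r := 0)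
    MeasurableSet.univ (Measure.measure_univ_pos.2 hμ)
  have hhalf : ∀ n : ℕ, ∃ A, MeasurableSet A ∧ 0 < μ A ∧ 2 ^ n * μ A ≤ μ A₀ := by
    intro n
    induction n with
    | zero => exact ⟨A₀, hA₀, hpos, by simp⟩
    | succ n ih =>
      obtain ⟨A, hA, hA0, hle⟩ := ih
      obtain ⟨B, hBA, hB, hB0, hlt⟩ := hna A hA hA0
      have hsplit : μ B + μ (A \ B) = μ A := by
        have := measure_inter_add_sdiff A hB (μ := μ)
        rwa [Set.inter_eq_right.2 hBA] at this
      -- Of the two pieces B and A \ B, both of positive measure, the smaller has at most half the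
      -- measure of A.
      suffices ∃ D, MeasurableSet D ∧ 0 < μ D ∧ 2 * μ D ≤ μ A by
        obtain ⟨D, hD, hD0, hDA⟩ := this
        refine ⟨D, hD, hD0, le_trans ?_ hle⟩
        rw [pow_succ, mul_assoc]
        gcongr
      rcases le_total (μ B) (μ (A \ B)) with h | h
      · exact ⟨B, hB, hB0, by rw [two_mul, ← hsplit]; gcongr⟩
      · refine ⟨A \ B, hA.diff hB, pos_iff_ne_zero.2 fun h0 => ?_, by
          rw [two_mul, ← hsplit]; gcongr⟩
        rw [h0, add_zero] at hsplit
        exact hlt.ne hsplit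
  obtain ⟨n, hn⟩ := ENNReal.exists_nat_mul_gt hη hfin.ne
  obtain ⟨A, hA, hA0, hle⟩ := hhalf n
  refine ⟨A, hA, hA0, ?_⟩
  by_contra! hge
  have h1 : (n : ENNReal) ≤ 2 ^ n := by exact_mod_cast Nat.lt_two_pow_self.le
  exact hn.not_ge ((mul_le_mul' h1 hge).trans hle)

/-- Every set of positive finite measure fills more than half of some level of each late column. -/
theorem Approximates.exists_level_mostly_in (hT : MeasurePreserving T μ μ) {B : ℕ → Set X}
    {h : ℕ → ℕ} (hc : ∀ n, IsColumn T (B n) (h n)) (happ : Approximates T μ B h) {A : Set X}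
    (hA : MeasurableSet A) (hA0 : 0 < μ A) (hAf : μ A < ⊤) :
    ∃ N, ∀ n ≥ N, ∃ i < h n, μ (B n) < 2 * μ (img T i (B n) ∩ A) := by
  obtain ⟨N, hN⟩ := happ A hA hAf (μ A / 2) (ENNReal.half_pos hA0.ne')
  refine ⟨N, fun n hn => ?_⟩
  obtain ⟨S, hS, hlt⟩ := hN n hn
  by_contra! hcon
  set U := ⋃ i ∈ S, img T i (B n) with hU
  have hUm : MeasurableSet U := (hc n).measurableSet_iUnion S
  have hdisj : (S : Set ℕ).PairwiseDisjoint fun i => img T i (B n) :=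
    (hc n).pairwiseDisjoint (c := 0) fun i hi => by
      have := Finset.mem_range.1 (hS hi); omega
  have h1 : 2 * μ (U ∩ A) ≤ μ U := by
    have e : U ∩ A = ⋃ i ∈ S, (img T i (B n) ∩ A) := by simp only [hU, Set.iUnion_inter]
    rw [e, hU, measure_biUnion_finset hdisj fun i _ => measurableSet_img _ (hc n).measurable_base]
    refine (mul_le_mul_right (measure_biUnion_finset_le S _) 2).trans ?_
    rw [Finset.mul_sum]
    refine Finset.sum_le_sum fun i hi => ?_
    rw [measure_img hT]
    exact hcon i (Finset.mem_range.1 (hS hi))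
  have hfin : μ (U ∩ A) ≠ ⊤ := measure_ne_top_of_subset Set.inter_subset_right hAf.ne
  -- If no level is more than half full, U gains no more of A than it wastes outside A, so it
  -- approximates A no better than the empty set does.
  have h2 : μ (U ∩ A) ≤ μ (U \ A) := by
    rw [← measure_inter_add_sdiff U hA, two_mul] at h1
    exact (ENNReal.add_le_add_iff_left hfin).1 h1
  have h3 : μ A ≤ μ (symmDiff A U) := by
    calc μ A = μ (A ∩ U) + μ (A \ U) := (measure_inter_add_sdiff A hUm).symm
      _ ≤ μ (U \ A) + μ (A \ U) := by rw [Set.inter_comm]; gcongr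
      _ = μ (symmDiff A U) := by
        rw [measure_symmDiff_eq hA.nullMeasurableSet hUm.nullMeasurableSet, add_comm]
  exact (hlt.trans_le ENNReal.half_le_self).not_ge h3

/-- Two sets of positive measure have translates that overlap. -/
theorem Approximates.exists_img_inter_pos [SigmaFinite μ] (hT : MeasurePreserving T μ μ)
    {B : ℕ → Set X} {h : ℕ → ℕ} (hc : ∀ n, IsColumn T (B n) (h n)) (happ : Approximates T μ B h)
    {E F : Set X} (hE : MeasurableSet E) (hF : MeasurableSet F) (hE0 : 0 < μ E) (hF0 : 0 < μ F) :
    ∃ i j : ℕ, 0 < μ (img T i E ∩ img T j F) := by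
  obtain ⟨E', hE', hEE', hE'0, hE'f⟩ := Measure.exists_subset_measure_lt_top hE hE0
  obtain ⟨F', hF', hFF', hF'0, hF'f⟩ := Measure.exists_subset_measure_lt_top hF hF0
  obtain ⟨N₁, h₁⟩ := happ.exists_level_mostly_in hT hc hE' hE'0 hE'f
  obtain ⟨N₂, h₂⟩ := happ.exists_level_mostly_in hT hc hF' hF'0 hF'f
  obtain ⟨i, -, hi⟩ := h₁ (max N₁ N₂) (le_max_left _ _)
  obtain ⟨j, -, hj⟩ := h₂ (max N₁ N₂) (le_max_right _ _)
  set L := B (max N₁ N₂) with hL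
  have hLm : MeasurableSet L := (hc _).measurable_base
  refine ⟨j, i, pos_iff_ne_zero.2 fun h0 => ?_⟩
  -- Both pieces are carried into the common level T^(i+j) L, where each fills more than half, so
  -- they cannot be disjoint.
  set P := img T j (img T i L ∩ E') with hP
  set Q := img T i (img T j L ∩ F') with hQ
  have hQm : MeasurableSet Q := measurableSet_img _ ((measurableSet_img _ hLm).inter hF')
  have hd : AEDisjoint μ P Q := by
    refine measure_mono_null (Set.inter_subset_inter (img_mono _ ?_) (img_mono _ ?_)) h0
    · exact Set.inter_subset_right.trans hEE'
    · exact Set.inter_subset_right.trans hFF'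
  have hsub : P ∪ Q ⊆ img T (i + j) L := by
    refine Set.union_subset ?_ ?_
    · rw [hP, img_inter, img_img, add_comm]; exact Set.inter_subset_left
    · rw [hQ, img_inter, img_img]; exact Set.inter_subset_left
  have h3 := measure_mono (μ := μ) hsub
  rw [measure_union₀ hQm.nullMeasurableSet hd, measure_img hT, measure_img hT,
    measure_img hT] at h3
  have h4 := ENNReal.add_lt_add hi hj
  rw [← mul_add, ← two_mul] at h4
  exact h4.not_ge (mul_le_mul_right h3 2)

/-- In a rank-one system on a nonatomic space, the forward images of every set of positive measure
cover almost every point. -/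
theorem Approximates.sweepsOut [SigmaFinite μ] (hna : IsNonatomic μ)
    (hT : MeasurePreserving T μ μ) {B : ℕ → Set X} {h : ℕ → ℕ} (hc : ∀ n, IsColumn T (B n) (h n))
    (happ : Approximates T μ B h) {E : Set X} (hE : MeasurableSet E) (hE0 : 0 < μ E) :
    SweepsOut T μ E := by
  unfold SweepsOut
  set U := ⋃ i : ℕ, img T i E with hU
  have hUm : MeasurableSet U := MeasurableSet.iUnion fun i => measurableSet_img _ hE
  have himg : ∀ k, img T k U = ⋃ i : ℕ, img T (k + i) E := fun k => by
    simp only [hU, img_iUnion, img_img]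
  have hanti : ∀ {i j : ℕ}, i ≤ j → img T j U ⊆ img T i U := by
    intro i j hij
    rw [himg, himg]
    refine Set.iUnion_subset fun l => ?_
    have : j + l = i + (j - i + l) := by omega
    rw [this]
    exact Set.subset_iUnion (fun l => img T (i + l) E) (j - i + l)
  set W := U \ img T 1 U with hW
  have hWm : MeasurableSet W := hUm.diff (measurableSet_img _ hUm)
  have hwander : ∀ {i j : ℕ}, i < j → Disjoint (img T i W) (img T j W) := by
    intro i j hij
    rw [show j = i + (j - i) by omega, ← img_img, img_disjoint_iff]
    refine Disjoint.mono_right ((img_mono _ Set.sdiff_subset).trans (hanti (by omega : 1 ≤ j - i)))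
      Set.disjoint_sdiff_left
  -- W is wandering. If it had positive measure, nonatomicity would split it into two pieces of
  -- positive measure none of whose translates meet.
  have hW0 : μ W = 0 := by
    by_contra hne
    obtain ⟨W₁, hsub, hW₁, hpos, hlt⟩ := hna W hWm (pos_iff_ne_zero.2 hne)
    have hpos' : 0 < μ (W \ W₁) := by
      refine pos_iff_ne_zero.2 fun h0 => hlt.ne ?_
      have := measure_inter_add_sdiff W hW₁ (μ := μ)
      rwa [Set.inter_eq_right.2 hsub, h0, add_zero] at this
    obtain ⟨i, j, hij⟩ := happ.exists_img_inter_pos hT hc hW₁ (hWm.diff hW₁) hpos hpos'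
    refine hij.ne' ?_
    have hd : Disjoint (img T i W₁) (img T j (W \ W₁)) := by
      rcases lt_trichotomy i j with hlt' | rfl | hlt'
      · exact (hwander hlt').mono (img_mono _ hsub) (img_mono _ Set.sdiff_subset)
      · exact img_disjoint_iff.2 Set.disjoint_sdiff_right
      · exact (hwander hlt').symm.mono (img_mono _ hsub) (img_mono _ Set.sdiff_subset)
    rw [hd.inter_eq, measure_empty]
  have hnull : ∀ k, μ (U \ img T k U) = 0 := by
    intro k
    induction k with
    | zero => simp
    | succ k ih =>
      refine measure_mono_null (t := (U \ img T k U) ∪ img T k W) ?_ ?_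
      · rintro x ⟨hxU, hx⟩
        by_cases hk : x ∈ img T k U
        · refine Or.inr ?_
          rw [← img_img] at hx
          simp only [hW, mem_img, Set.mem_sdiff] at hx hk ⊢
          exact ⟨hk, hx⟩
        · exact Or.inl ⟨hxU, hk⟩
      · refine measure_union_null ih ?_
        rw [measure_img hT, hW0]
  by_contra hne
  -- Up to a null set T^i E ⊆ U ⊆ T^j U, which is disjoint from T^j of the complement of U.
  obtain ⟨i, j, hij⟩ := happ.exists_img_inter_pos hT hc hE hUm.compl hE0 (pos_iff_ne_zero.2 hne)
  refine hij.ne' (measure_mono_null (t := U \ img T j U) ?_ (hnull j))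
  rintro x ⟨hx, hx'⟩
  refine ⟨Set.mem_iUnion.2 ⟨i, hx⟩, fun hxj => ?_⟩
  rw [mem_img] at hx' hxj
  exact hx' hxj

theorem Approximates.exists_measure_base_lt [SigmaFinite μ] (hna : IsNonatomic μ) (hμ : μ ≠ 0)
    (hT : MeasurePreserving T μ μ) {B : ℕ → Set X} {h : ℕ → ℕ} (hc : ∀ n, IsColumn T (B n) (h n))
    (happ : Approximates T μ B h) {η : ENNReal} (hη : η ≠ 0) :
    ∃ N, ∀ n ≥ N, μ (B n) < η := by
  obtain ⟨A, hA, hA0, hAlt⟩ := hna.exists_measure_lt hμ (ENNReal.half_pos hη).ne'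
  obtain ⟨N, hN⟩ := happ.exists_level_mostly_in hT hc hA hA0 hAlt.lt_top
  refine ⟨N, fun n hn => ?_⟩
  obtain ⟨i, -, hi⟩ := hN n hn
  calc μ (B n) < 2 * μ (img T i (B n) ∩ A) := hi
    _ ≤ 2 * (η / 2) := by gcongr; exact (measure_mono Set.inter_subset_right).trans hAlt.le
    _ = η := ENNReal.mul_div_cancel two_ne_zero ENNReal.ofNat_ne_top

end Sweeping

/-! ### Refining a column by a trimmed late column. -/

section Refinement

variable {X : Type*} [MeasurableSpace X] {T : X ≃ᵐ X} {μ : Measure X}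

/-- The union of the levels over `A` at the heights of the bases of `r` subcolumns of height `g`
with spacers `s`. -/
def cutUnion (T : X ≃ᵐ X) (g r : ℕ) (s : ℕ → ℕ) (A : Set X) : Set X :=
  ⋃ i ∈ Finset.range r, img T (∑ k ∈ Finset.range i, (g + s k)) A

theorem IsColumn.trim {B : Set X} {h p : ℕ} (hB : IsColumn T B h) (hp : p < h) :
    IsColumn T (img T p B) (h - p) where
  height_pos := by omega
  measurable_base := measurableSet_img _ hB.measurable_base
  disjoint_levels i hi j hj hij := by
    rw [img_img, img_img]
    exact hB.disjoint_levels _ (by omega) _ (by omega) (by omega)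

theorem measure_iUnion_img_le (hT : MeasurePreserving T μ μ) (S : Finset ℕ) (A : Set X) :
    μ (⋃ i ∈ S, img T i A) ≤ S.card * μ A := by
  refine (measure_biUnion_finset_le S _).trans (le_of_eq ?_)
  simp [measure_img hT]

/-- A spaced set of heights is the set of heights of the bases of subcolumns. -/
theorem exists_spacers {g : ℕ} (S : Finset ℕ) :
    ∀ g' : ℕ, 0 ∈ S → (∀ i ∈ S, ∀ j ∈ S, i < j → i + g ≤ j) → (∀ i ∈ S, i + g ≤ g') →
      ∃ s : ℕ → ℕ, ∑ k ∈ Finset.range S.card, (g + s k) = g' ∧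
        ∀ j, j ∈ S ↔ ∃ i < S.card, ∑ k ∈ Finset.range i, (g + s k) = j := by
  induction S using Finset.induction_on_max with
  | empty => simp
  | insert a S hmax ih =>
    intro g' h0 hsp htop
    have haS : a ∉ S := fun h => lt_irrefl _ (hmax a h)
    rw [Finset.card_insert_of_notMem haS]
    have htop_a := htop a (Finset.mem_insert_self _ _)
    rcases S.eq_empty_or_nonempty with rfl | ⟨b, hb⟩
    · have ha : a = 0 := by simpa [eq_comm] using h0
      subst ha
      refine ⟨fun _ => g' - g, ?_, ?_⟩
      · simp; omega
      · intro j
        simp [eq_comm]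
    · have h0S : 0 ∈ S := by
        rcases Finset.mem_insert.1 h0 with h | h
        · have := hmax b hb; omega
        · exact h
      obtain ⟨s, hs, hmem⟩ := ih a h0S
        (fun i hi j hj => hsp i (Finset.mem_insert_of_mem hi) j (Finset.mem_insert_of_mem hj))
        (fun i hi => hsp i (Finset.mem_insert_of_mem hi) a (Finset.mem_insert_self _ _)
          (hmax i hi))
      -- The spacers found below the largest height a fill the column exactly up to a; the last
      -- subcolumn takes what is left up to `g'`.
      set s' : ℕ → ℕ := fun k => if k < S.card then s k else g' - a - g with hs'
      have hsum : ∀ i ≤ S.card, ∑ k ∈ Finset.range i, (g + s' k) =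
          ∑ k ∈ Finset.range i, (g + s k) := by
        intro i hi
        refine Finset.sum_congr rfl fun k hk => ?_
        simp only [hs', if_pos (show k < S.card by have := Finset.mem_range.1 hk; omega)]
      refine ⟨s', ?_, ?_⟩
      · rw [Finset.sum_range_succ, hsum _ le_rfl, hs, hs']
        simp; omega
      · intro j
        rw [Finset.mem_insert, hmem]
        constructor
        · rintro (rfl | ⟨i, hi, rfl⟩)
          · exact ⟨S.card, by omega, by rw [hsum _ le_rfl, hs]⟩
          · exact ⟨i, by omega, hsum i hi.le⟩
        · rintro ⟨i, hi, rfl⟩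
          rcases Nat.lt_succ_iff_lt_or_eq.1 hi with h | rfl
          · exact Or.inr ⟨i, h, (hsum i h.le).symm⟩
          · exact Or.inl (by rw [hsum _ le_rfl, hs])

open Classical in
-- The error decomposes level by level, so it can be minimised by an independent choice on each
-- level.
theorem IsColumn.measure_symmDiff {B : Set X} {h : ℕ} (hB : IsColumn T B h) {E : Set X}
    (hE : MeasurableSet E) {S : Finset ℕ} (hS : S ⊆ Finset.range h) :
    μ (symmDiff E (⋃ i ∈ S, img T i B)) = μ (E \ ⋃ i ∈ Finset.range h, img T i B) +
      ∑ i ∈ Finset.range h, if i ∈ S then μ (img T i B \ E) else μ (img T i B ∩ E) := by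
  set V := ⋃ i ∈ Finset.range h, img T i B with hV
  set U := ⋃ i ∈ S, img T i B with hU
  have hVm : MeasurableSet V := hB.measurableSet_iUnion _
  have hUm : MeasurableSet U := hB.measurableSet_iUnion _
  have hUV : U ⊆ V := Set.biUnion_subset_biUnion_left hS
  have hd : ((Finset.range h : Finset ℕ) : Set ℕ).PairwiseDisjoint fun i => img T i B :=
    hB.pairwiseDisjoint (c := 0) fun i hi => by
      have := Finset.mem_range.1 (Finset.mem_coe.1 hi); omega
  have hmemU : ∀ i < h, ∀ x ∈ img T i B, (x ∈ U ↔ i ∈ S) := by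
    intro i hi x hx
    simp only [hU, Set.mem_iUnion]
    constructor
    · rintro ⟨j, hj, hxj⟩
      by_contra hiS
      refine Set.disjoint_left.1 (hB.disjoint_levels i hi j (Finset.mem_range.1 (hS hj)) ?_) hx hxj
      rintro rfl
      exact hiS hj
    · intro hiS
      exact ⟨i, hiS, hx⟩
  rw [← measure_inter_add_sdiff (symmDiff E U) hVm, add_comm]
  congr 1
  · congr 1
    ext x
    simp only [Set.mem_sdiff, Set.mem_symmDiff]
    have := @hUV x
    tauto
  · have e : symmDiff E U ∩ V = ⋃ i ∈ Finset.range h, (img T i B ∩ symmDiff E U) := by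
      rw [Set.inter_comm, hV]
      simp only [Set.iUnion_inter]
    rw [e, measure_biUnion_finset
      (fun i hi j hj hij => (hd hi hj hij).mono Set.inter_subset_left Set.inter_subset_left)
      (fun i _ => (measurableSet_img _ hB.measurable_base).inter (hE.symmDiff hUm))]
    refine Finset.sum_congr rfl fun i hi => ?_
    have hm := hmemU i (Finset.mem_range.1 hi)
    split_ifs with hiS <;> congr 1 <;> ext x <;>
      simp only [Set.mem_sdiff, Set.mem_symmDiff, Set.mem_inter_iff] <;> have := hm x <;> tauto

open Classical in
/-- Among all unions of levels, the one made of the levels that lie mostly in `E` approximates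
`E` best. -/
theorem IsColumn.measure_symmDiff_filter_le (hT : MeasurePreserving T μ μ) {B : Set X} {h : ℕ}
    (hB : IsColumn T B h) {E : Set X} (hE : MeasurableSet E) (hEf : μ E ≠ ⊤) {S : Finset ℕ}
    (hS : S ⊆ Finset.range h) :
    μ (symmDiff E (⋃ i ∈ (Finset.range h).filter fun i => μ B < 2 * μ (img T i B ∩ E),
      img T i B)) ≤ μ (symmDiff E (⋃ i ∈ S, img T i B)) := by
  rw [hB.measure_symmDiff hE (Finset.filter_subset _ _), hB.measure_symmDiff hE hS]
  gcongr with i hi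
  have hsplit : μ (img T i B ∩ E) + μ (img T i B \ E) = μ B := by
    rw [measure_inter_add_sdiff _ hE, measure_img hT]
  have hf : μ (img T i B ∩ E) ≠ ⊤ := measure_ne_top_of_subset Set.inter_subset_right hEf
  simp only [Finset.mem_filter, hi, true_and]
  rw [← hsplit, two_mul]
  split_ifs with h1 h2 h2
  · exact le_rfl
  · exact ((ENNReal.add_lt_add_iff_left hf).1 h1).le
  · exact (ENNReal.add_le_add_iff_left hf).1 (not_lt.1 h1)
  · exact le_rfl

/-- A column is approximated by cutting and stacking a column that is obtained from a late member
of an approximating sequence by removing a few levels at the bottom. -/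
theorem Approximates.exists_refinement [SigmaFinite μ] (hna : IsNonatomic μ) (hμ : μ ≠ 0)
    (hT : MeasurePreserving T μ μ) {B : ℕ → Set X} {h : ℕ → ℕ} (hc : ∀ n, IsColumn T (B n) (h n))
    (happ : Approximates T μ B h) {E : Set X} {g : ℕ} (hE : IsColumn T E g) (hE0 : 0 < μ E)
    (hEf : μ E < ⊤) {Y : Set X} (hY : MeasurableSet Y) (hYf : μ Y < ⊤) {ε : ENNReal} (hε : ε ≠ 0)
    (N : ℕ) :
    ∃ n ≥ N, ∃ p < h n, 0 < μ (B n) ∧ μ (B n) < ⊤ ∧ ∃ (r : ℕ) (s : ℕ → ℕ), 2 ≤ r ∧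
      h n - p = ∑ k ∈ Finset.range r, (g + s k) ∧
      μ (symmDiff E (cutUnion T g r s (img T p (B n)))) < ε ∧
      μ (Y ∩ ⋃ i ∈ Finset.range p, img T i (B n)) < ε := by
  classical
  have hsweep := happ.sweepsOut hna hT hc hE.measurable_base hE0
  obtain ⟨J, hJ⟩ : ∃ J : ℕ, μ (Y \ ⋃ j ∈ Finset.range J, img T j E) < ε / 2 := by
    have hanti : Antitone fun J : ℕ => Y \ ⋃ j ∈ Finset.range J, img T j E := by
      intro J J' hJJ
      exact Set.sdiff_subset_sdiff_right (Set.biUnion_subset_biUnion_left (Finset.range_mono hJJ))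
    have hlim := tendsto_measure_iInter_atTop (μ := μ)
      (fun J => (hY.diff (hE.measurableSet_iUnion (Finset.range J))).nullMeasurableSet) hanti
      ⟨0, measure_ne_top_of_subset Set.sdiff_subset hYf.ne⟩
    have hz : μ (⋂ J : ℕ, Y \ ⋃ j ∈ Finset.range J, img T j E) = 0 := by
      refine measure_mono_null ?_ hsweep
      intro x hx hxU
      obtain ⟨j, hj⟩ := Set.mem_iUnion.1 hxU
      exact (Set.mem_iInter.1 hx (j + 1)).2 (Set.mem_biUnion (Finset.mem_coe.2
        (Finset.mem_range.2 (Nat.lt_succ_self j))) hj)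
    rw [hz] at hlim
    exact (hlim.eventually_lt_const (ENNReal.half_pos hε)).exists
  -- The multiples of η needed below are g + 2, to force two subcolumns, g + 1, for the closeness to
  -- E, and J + J(g + 1), for the part of Y lost at the bottom.
  obtain ⟨η, hη0, hη⟩ := ENNReal.exists_nnreal_pos_mul_lt
    (a := ((J + J * (g + 1) + (g + 2) : ℕ) : ENNReal)) (b := min (μ E) (ε / 2))
    (ENNReal.natCast_ne_top _) (by simp [hE0.ne', hε])
  have hη0' : (η : ENNReal) ≠ 0 := by exact_mod_cast hη0.ne'
  have hK : ∀ K : ℕ, K ≤ J + J * (g + 1) + (g + 2) → (K : ENNReal) * η < min (μ E) (ε / 2) := by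
    intro K hK
    refine lt_of_le_of_lt ?_ hη
    rw [mul_comm]
    gcongr
  obtain ⟨N₁, hN₁⟩ := happ.exists_measure_base_lt hna hμ hT hc hη0'
  obtain ⟨N₂, hN₂⟩ := happ E hE.measurable_base hEf η (pos_iff_ne_zero.2 hη0')
  set n := max N (max N₁ N₂) with hn
  obtain ⟨S₀, hS₀, hES₀⟩ := hN₂ n (by omega)
  have hL := hN₁ n (by omega)
  set L := B n with hLdef
  have hcol : IsColumn T L (h n) := hc n
  have hLm := hcol.measurable_base
  set S₁ := (Finset.range (h n)).filter fun i => μ L < 2 * μ (img T i L ∩ E) with hS₁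
  have hES₁ : μ (symmDiff E (⋃ i ∈ S₁, img T i L)) < η :=
    (hcol.measure_symmDiff_filter_le hT hE.measurable_base hEf.ne hS₀).trans_lt hES₀
  -- Moving up by j - i < g sends E off itself. Two such levels would therefore give disjoint parts
  -- of T^j L, each more than half of it.
  have hspaced : ∀ i ∈ S₁, ∀ j ∈ S₁, i < j → i + g ≤ j := by
    intro i hi j hj hij
    by_contra! hlt
    have hi' := (Finset.mem_filter.1 hi).2
    have hj' := (Finset.mem_filter.1 hj).2
    have hd : Disjoint (img T (j - i) (img T i L ∩ E)) (img T j L ∩ E) := by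
      rw [img_inter]
      refine Disjoint.mono Set.inter_subset_right Set.inter_subset_right ?_
      have := hE.disjoint_levels (j - i) (by omega) 0 hE.height_pos (by omega)
      simpa using this
    have hsub : img T (j - i) (img T i L ∩ E) ∪ (img T j L ∩ E) ⊆ img T j L := by
      refine Set.union_subset ?_ Set.inter_subset_left
      rw [img_inter, img_img, Nat.sub_add_cancel hij.le]
      exact Set.inter_subset_left
    have h3 := measure_mono (μ := μ) hsub
    rw [measure_union hd ((measurableSet_img _ hLm).inter hE.measurable_base), measure_img hT,
      measure_img hT] at h3
    have h4 := ENNReal.add_lt_add hi' hj'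
    rw [← mul_add, ← two_mul] at h4
    exact h4.not_ge (mul_le_mul_right h3 2)
  -- A subcolumn of height g must fit below the top; this drops at most g levels, each of measure
  -- below η.
  set S₂ := S₁.filter fun i => i + g ≤ h n with hS₂
  have hES₂ : μ (symmDiff E (⋃ i ∈ S₂, img T i L)) ≤ (g + 1 : ℕ) * η := by
    set R := (Finset.range (h n)).filter fun i => h n < i + g with hR
    have hsub : symmDiff E (⋃ i ∈ S₂, img T i L) ⊆
        symmDiff E (⋃ i ∈ S₁, img T i L) ∪ ⋃ i ∈ R, img T i L := by
      rintro x (⟨hxE, hx⟩ | ⟨hx, hxE⟩)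
      · by_cases hx1 : x ∈ ⋃ i ∈ S₁, img T i L
        · right
          simp only [Set.mem_iUnion] at hx hx1 ⊢
          obtain ⟨i, hi, hxi⟩ := hx1
          refine ⟨i, Finset.mem_filter.2 ⟨(Finset.mem_filter.1 hi).1, ?_⟩, hxi⟩
          by_contra! hle
          exact hx ⟨i, Finset.mem_filter.2 ⟨hi, hle⟩, hxi⟩
        · exact Or.inl (Or.inl ⟨hxE, hx1⟩)
      · exact Or.inl (Or.inr ⟨Set.biUnion_subset_biUnion_left (Finset.filter_subset _ _) hx, hxE⟩)
    have hcard : R.card ≤ g := by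
      have : R ⊆ Finset.Ico (h n - g) (h n) := by
        intro i hi
        simp only [hR, Finset.mem_filter, Finset.mem_range, Finset.mem_Ico] at hi ⊢
        omega
      have := Finset.card_le_card this
      rw [Nat.card_Ico] at this
      omega
    calc _ ≤ μ (symmDiff E (⋃ i ∈ S₁, img T i L)) + μ (⋃ i ∈ R, img T i L) :=
          (measure_mono hsub).trans (measure_union_le _ _)
      _ ≤ η + (g : ENNReal) * η := by
          gcongr
          refine (measure_iUnion_img_le hT R L).trans ?_
          gcongr
      _ = _ := by push_cast; ring
  have hcard : 2 ≤ S₂.card := by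
    by_contra! hlt
    have h1 : μ (⋃ i ∈ S₂, img T i L) ≤ η := by
      refine (measure_iUnion_img_le hT S₂ L).trans ?_
      calc (S₂.card : ENNReal) * μ L ≤ (1 : ℕ) * η := by gcongr; omega
        _ = η := by simp
    have h2 : μ E ≤ (g + 2 : ℕ) * η := by
      calc μ E ≤ μ (symmDiff E (⋃ i ∈ S₂, img T i L) ∪ ⋃ i ∈ S₂, img T i L) := by
            refine measure_mono fun x hx => ?_
            by_cases hx' : x ∈ ⋃ i ∈ S₂, img T i L
            · exact Or.inr hx'
            · exact Or.inl (Or.inl ⟨hx, hx'⟩)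
        _ ≤ (g + 1 : ℕ) * η + η := (measure_union_le _ _).trans (add_le_add hES₂ h1)
        _ = _ := by push_cast; ring
    exact ((hK (g + 2) (by omega)).trans_le (min_le_left _ _)).not_ge h2
  have hne : S₂.Nonempty := Finset.card_pos.1 (by omega)
  -- The first subcolumn must start at height 0, as spacers are only put above subcolumns; hence the
  -- levels below p are removed.
  set p := S₂.min' hne with hp
  have hpS₂ : p ∈ S₂ := S₂.min'_mem hne
  have hpS₁ : p ∈ S₁ := (Finset.mem_filter.1 hpS₂).1
  have hph : p < h n := Finset.mem_range.1 (Finset.mem_filter.1 hpS₁).1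
  have hpmin : ∀ i ∈ S₂, p ≤ i := fun i hi => S₂.min'_le i hi
  have hLpos : 0 < μ L := by
    have h1 := (Finset.mem_filter.1 hpS₁).2
    refine pos_iff_ne_zero.2 fun h0 => ?_
    have : μ (img T p L ∩ E) = 0 :=
      measure_mono_null Set.inter_subset_left (by rw [measure_img hT, h0])
    rw [this, h0] at h1
    simp at h1
  set S := S₂.image fun i => i - p with hS
  have hScard : S.card = S₂.card := by
    refine Finset.card_image_of_injOn fun i hi j hj hij => ?_
    have := hpmin i hi
    have := hpmin j hj
    change i - p = j - p at hij
    omega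
  obtain ⟨s, hs, hmem⟩ := exists_spacers (g := g) S (h n - p)
    (Finset.mem_image.2 ⟨p, hpS₂, by simp⟩)
    (by
      intro i hi j hj hij
      obtain ⟨i', hi', rfl⟩ := Finset.mem_image.1 hi
      obtain ⟨j', hj', rfl⟩ := Finset.mem_image.1 hj
      have := hspaced i' (Finset.mem_filter.1 hi').1 j' (Finset.mem_filter.1 hj').1 (by omega)
      have := hpmin i' hi'
      omega)
    (by
      intro i hi
      obtain ⟨i', hi', rfl⟩ := Finset.mem_image.1 hi
      have := (Finset.mem_filter.1 hi').2
      have := hpmin i' hi'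
      omega)
  have hcut : cutUnion T g S.card s (img T p L) = ⋃ i ∈ S₂, img T i L := by
    ext x
    simp only [cutUnion, img_img, Set.mem_iUnion, Finset.mem_range, exists_prop]
    constructor
    · rintro ⟨i, hi, hx⟩
      obtain ⟨j, hj, hij⟩ := Finset.mem_image.1 ((hmem _).2 ⟨i, hi, rfl⟩)
      refine ⟨j, hj, ?_⟩
      rwa [← hij, Nat.sub_add_cancel (hpmin j hj)] at hx
    · rintro ⟨j, hj, hx⟩
      obtain ⟨i, hi, hij⟩ := (hmem (j - p)).1 (Finset.mem_image_of_mem _ hj)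
      refine ⟨i, hi, ?_⟩
      rwa [hij, Nat.sub_add_cancel (hpmin j hj)]
  refine ⟨n, le_max_left _ _, p, hph, hLpos, hL.trans_le le_top, S.card, s, by omega, hs.symm, ?_, ?_⟩
  · rw [hcut]
    exact hES₂.trans_lt ((hK _ (by omega)).trans_le ((min_le_right _ _).trans ENNReal.half_le_self))
  -- Take a point of T^j E with j < J in a removed level i. Either i < J, or its image under T^(-j)
  -- lies in E at height i - j < p, below all chosen levels, hence in the approximation error of E.
  · have hsub : Y ∩ ⋃ i ∈ Finset.range p, img T i L ⊆ (Y \ ⋃ j ∈ Finset.range J, img T j E) ∪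
        ((⋃ i ∈ Finset.range J, img T i L) ∪
          ⋃ j ∈ Finset.range J, img T j (symmDiff E (⋃ i ∈ S₂, img T i L))) := by
      rintro x ⟨hxY, hx⟩
      by_cases hxJ : x ∈ ⋃ j ∈ Finset.range J, img T j E
      · right
        simp only [Set.mem_iUnion, Finset.mem_range] at hx hxJ
        obtain ⟨i, hi, hxi⟩ := hx
        obtain ⟨j, hj, hxj⟩ := hxJ
        by_cases hiJ : i < J
        · left
          simp only [Set.mem_iUnion, Finset.mem_range]
          exact ⟨i, hiJ, hxi⟩
        · right
          simp only [Set.mem_iUnion, Finset.mem_range]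
          refine ⟨j, hj, ?_⟩
          rw [show i = j + (i - j) by omega, ← img_img] at hxi
          rw [mem_img] at hxi hxj ⊢
          refine Or.inl ⟨hxj, fun hU => ?_⟩
          simp only [Set.mem_iUnion] at hU
          obtain ⟨l, hl, hxl⟩ := hU
          have h1 := hpmin l hl
          have h2 := (Finset.mem_filter.1 (Finset.mem_filter.1 hl).1).1
          rw [Finset.mem_range] at h2
          exact Set.disjoint_left.1 (hcol.disjoint_levels l h2 (i - j) (by omega) (by omega))
            hxl hxi
      · exact Or.inl ⟨hxY, hxJ⟩
    calc _ ≤ _ := (measure_mono hsub).trans (measure_union_le _ _)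
      _ ≤ μ (Y \ ⋃ j ∈ Finset.range J, img T j E) +
          ((J : ENNReal) * η + J * ((g + 1 : ℕ) * η)) := by
        gcongr
        refine (measure_union_le _ _).trans (add_le_add ?_ ?_)
        · refine (measure_iUnion_img_le hT _ _).trans ?_
          rw [Finset.card_range]
          gcongr
        · refine (measure_iUnion_img_le hT _ _).trans ?_
          rw [Finset.card_range]
          gcongr
      _ = μ (Y \ ⋃ j ∈ Finset.range J, img T j E) + (J + J * (g + 1) : ℕ) * η := by
        push_cast; ring
      _ < ε / 2 + ε / 2 :=
        ENNReal.add_lt_add hJ ((hK _ (by omega)).trans_le (min_le_right _ _))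
      _ = ε := ENNReal.add_halves ε

end Refinement

end RankOne

namespace RankOne

/-! ### Making approximate nesting exact. -/

section Limits

variable {X : Type*} [MeasurableSpace X] {T : X ≃ᵐ X} {μ : Measure X}

theorem sum_range_add_le {g i r : ℕ} (s : ℕ → ℕ) (hi : i < r) :
    ∑ k ∈ Finset.range i, (g + s k) + g ≤ ∑ k ∈ Finset.range r, (g + s k) :=
  calc _ ≤ ∑ k ∈ Finset.range (i + 1), (g + s k) := by
        rw [Finset.sum_range_succ]; omega
    _ ≤ _ := Finset.sum_le_sum_of_subset (Finset.range_mono hi)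

theorem mem_cutUnion {g r : ℕ} {s : ℕ → ℕ} {A : Set X} {x : X} :
    x ∈ cutUnion T g r s A ↔ ∃ i < r, x ∈ img T (∑ k ∈ Finset.range i, (g + s k)) A := by
  simp [cutUnion]

theorem symmDiff_cutUnion_subset {g r : ℕ} {s : ℕ → ℕ} (A A' : Set X) :
    symmDiff (cutUnion T g r s A) (cutUnion T g r s A') ⊆ cutUnion T g r s (symmDiff A A') := by
  rintro x (⟨hx, hx'⟩ | ⟨hx, hx'⟩) <;> rw [mem_cutUnion] at hx hx' ⊢ <;>
    obtain ⟨i, hi, hxi⟩ := hx <;> refine ⟨i, hi, ?_⟩ <;> rw [img_symmDiff]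
  · exact Or.inl ⟨hxi, fun h => hx' ⟨i, hi, h⟩⟩
  · exact Or.inr ⟨hxi, fun h => hx' ⟨i, hi, h⟩⟩

theorem measure_cutUnion_le (hT : MeasurePreserving T μ μ) {g r : ℕ} {s : ℕ → ℕ} (A : Set X) :
    μ (cutUnion T g r s A) ≤ r * μ A := by
  refine (measure_biUnion_finset_le _ _).trans (le_of_eq ?_)
  simp [measure_img hT]

theorem IsColumn.cutUnion {g r : ℕ} {s : ℕ → ℕ} {A : Set X} (hg : 0 < g)
    (hA : IsColumn T A (∑ k ∈ Finset.range r, (g + s k))) :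
    IsColumn T (cutUnion T g r s A) g where
  height_pos := hg
  measurable_base := (Finset.range r).measurableSet_biUnion fun _ _ =>
    measurableSet_img _ hA.measurable_base
  disjoint_levels i hi j hj hij := by
    rw [Set.disjoint_left]
    intro x hx hx'
    rw [mem_img, mem_cutUnion] at hx hx'
    obtain ⟨a, ha, hxa⟩ := hx
    obtain ⟨b, hb, hxb⟩ := hx'
    rw [← mem_img, img_img] at hxa hxb
    have h1 := sum_range_add_le (g := g) s ha
    have h2 := sum_range_add_le (g := g) s hb
    refine Set.disjoint_left.1 (hA.disjoint_levels _ (by omega) _ (by omega) ?_) hxa hxb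
    rcases lt_trichotomy a b with h | rfl | h
    · have := sum_range_add_le (g := g) s h; omega
    · omega
    · have := sum_range_add_le (g := g) s h; omega

/-- Every null set is contained in an invariant null set. -/
theorem exists_invariant_null_superset (hT : MeasurePreserving T μ μ) {Z : Set X}
    (hZ : MeasurableSet Z) (hZ0 : μ Z = 0) :
    ∃ N, MeasurableSet N ∧ μ N = 0 ∧ Z ⊆ N ∧ ∀ k, img T k N = N := by
  set W := ⋃ j : ℕ, (⇑T)^[j] ⁻¹' Z with hW
  have hWm : MeasurableSet W := MeasurableSet.iUnion fun j => (T.measurable.iterate j) hZ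
  -- W already absorbs all preimages of Z, so adding its forward images gives sets of whole
  -- two-sided orbits.
  have hW0 : μ W = 0 := measure_iUnion_null fun j => by
    rw [(hT.iterate j).measure_preimage hZ.nullMeasurableSet, hZ0]
  set N := ⋃ i : ℕ, img T i W with hN
  have hZW : Z ⊆ W := fun x hx => Set.mem_iUnion.2 ⟨0, hx⟩
  have hWN : W ⊆ N := fun x hx => Set.mem_iUnion.2 ⟨0, by simpa using hx⟩
  have h1 : img T 1 N = N := by
    refine Set.Subset.antisymm ?_ ?_
    · rw [hN, img_iUnion]
      refine Set.iUnion_subset fun i => ?_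
      rw [img_img]
      exact Set.subset_iUnion (fun i => img T i W) (1 + i)
    · refine Set.iUnion_subset fun i => ?_
      cases i with
      | zero =>
        rw [img_zero]
        intro x hx
        rw [mem_img]
        refine hWN ?_
        obtain ⟨j, hj⟩ := Set.mem_iUnion.1 hx
        refine Set.mem_iUnion.2 ⟨j + 1, ?_⟩
        simpa using hj
      | succ i =>
        rw [add_comm, ← img_img]
        exact img_mono 1 (Set.subset_iUnion (fun i => img T i W) i)
  refine ⟨N, MeasurableSet.iUnion fun i => measurableSet_img i hWm,
    measure_iUnion_null fun i => by rw [measure_img hT, hW0], hZW.trans hWN, fun k => ?_⟩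
  induction k with
  | zero => simp
  | succ k ih => rw [add_comm, ← img_img, ih, h1]

/-- The base of the `k`-th column, as predicted by the column `d` steps later. -/
def descend (T : X ≃ᵐ X) (E : ℕ → Set X) (g r : ℕ → ℕ) (s : ℕ → ℕ → ℕ) : ℕ → ℕ → Set X
  | k, 0 => E k
  | k, d + 1 => cutUnion T (g k) (r k) (s k) (descend T E g r s (k + 1) d)

/-- Columns that are nested up to summable errors can be modified so that they are exactly nested,
with small total change. -/
theorem exists_exact_columns (hT : MeasurePreserving T μ μ) {E : ℕ → Set X} {g r : ℕ → ℕ}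
    {s : ℕ → ℕ → ℕ} {τ : ℕ → ENNReal} (hE : ∀ k, IsColumn T (E k) (g k))
    (hg : ∀ k, g (k + 1) = ∑ l ∈ Finset.range (r k), (g k + s k l))
    (hτ : ∀ k, g k * μ (symmDiff (E k) (cutUnion T (g k) (r k) (s k) (E (k + 1)))) ≤ τ k)
    (hsum : ∑' k, τ k ≠ ⊤) :
    ∃ B : ℕ → Set X, (∀ k, IsColumn T (B k) (g k)) ∧
      (∀ k, B k = cutUnion T (g k) (r k) (s k) (B (k + 1))) ∧
      ∀ k, g k * μ (symmDiff (E k) (B k)) ≤ ∑' d, τ (d + k) := by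
  set U := descend T E g r s with hU
  have hU0 : ∀ k, U k 0 = E k := fun k => rfl
  have hUs : ∀ k d, U k (d + 1) = cutUnion T (g k) (r k) (s k) (U (k + 1) d) := fun k d => rfl
  have hcol : ∀ d k, IsColumn T (U k d) (g k) := by
    intro d
    induction d with
    | zero => exact hE
    | succ d ih =>
      intro k
      rw [hUs]
      refine IsColumn.cutUnion (hE k).height_pos ?_
      rw [← hg]
      exact ih (k + 1)
  have hgk : ∀ k, (g k : ENNReal) ≠ 0 := fun k => by exact_mod_cast (hE k).height_pos.ne'
  have hstep : ∀ d k, g k * μ (symmDiff (U k d) (U k (d + 1))) ≤ τ (d + k) := by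
    intro d
    induction d with
    | zero => intro k; rw [zero_add, zero_add]; exact hτ k
    | succ d ih =>
      intro k
      -- The r_k subcolumns of height g_k fit into g_(k+1), so an error weighted by the height does
      -- not grow when it is passed down to an earlier column.
      have hrg : (g k : ENNReal) * r k ≤ g (k + 1) := by
        have : g k * r k ≤ g (k + 1) := by
          rw [hg k, Finset.sum_add_distrib]
          simp [mul_comm]
        exact_mod_cast this
      calc g k * μ (symmDiff (U k (d + 1)) (U k (d + 1 + 1)))
          ≤ g k * (r k * μ (symmDiff (U (k + 1) d) (U (k + 1) (d + 1)))) := by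
            gcongr
            rw [hUs, hUs k (d + 1)]
            exact (measure_mono (symmDiff_cutUnion_subset _ _)).trans (measure_cutUnion_le hT _)
        _ ≤ g (k + 1) * μ (symmDiff (U (k + 1) d) (U (k + 1) (d + 1))) := by
            rw [← mul_assoc]; gcongr
        _ ≤ τ (d + 1 + k) := by
            have := ih (k + 1)
            rwa [show d + (k + 1) = d + 1 + k by omega] at this
  have hstep' : ∀ d k, μ (symmDiff (U k d) (U k (d + 1))) ≤ τ (d + k) := fun d k => by
    refine le_trans ?_ (hstep d k)
    refine le_mul_of_one_le_left zero_le ?_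
    exact_mod_cast (hE k).height_pos
  have htail : ∀ k, ∑' d, τ (d + k) ≠ ⊤ := fun k =>
    ne_top_of_le_ne_top hsum (ENNReal.tsum_comp_le_tsum_of_injective (add_left_injective k) τ)
  set D := fun k d => symmDiff (U k d) (U k (d + 1)) with hD
  have hDm : ∀ k d, MeasurableSet (D k d) := fun k d =>
    (hcol d k).measurable_base.symmDiff (hcol (d + 1) k).measurable_base
  -- By Borel–Cantelli, almost every point changes its membership in `U k d` only finitely often in
  -- d. Removing an invariant null set containing the exceptions makes disjointness and nesting hold
  -- everywhere.
  set Z := ⋃ k, limsup (D k) atTop with hZ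
  have hZm : MeasurableSet Z :=
    MeasurableSet.iUnion fun k => MeasurableSet.measurableSet_limsup (hDm k)
  have hZ0 : μ Z = 0 := measure_iUnion_null fun k =>
    measure_limsup_atTop_eq_zero (ne_top_of_le_ne_top (htail k)
      (ENNReal.tsum_le_tsum fun d => hstep' d k))
  obtain ⟨N, hNm, hN0, hZN, hNinv⟩ := exists_invariant_null_superset hT hZm hZ0
  set B := fun k => limsup (U k) atTop \ N with hB
  have hBmem : ∀ {k x}, x ∈ B k ↔ (∃ᶠ d in atTop, x ∈ U k d) ∧ x ∉ N := fun {k x} => by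
    rw [hB, Set.mem_sdiff, mem_limsup_iff_frequently_mem]
  have hsymmN : ∀ {x} (i : ℕ), (⇑T.symm)^[i] x ∈ N ↔ x ∈ N := fun {x} i => by
    rw [← mem_img, hNinv]
  have hmemU : ∀ {x} k d, x ∉ D k d → (x ∈ U k d ↔ x ∈ U k (d + 1)) := fun {x} k d hx => by
    simp only [hD, Set.mem_symmDiff] at hx
    tauto
  have hevent : ∀ {k x}, x ∈ B k → ∀ᶠ d in atTop, x ∈ U k d := by
    intro k x hx
    rw [hBmem] at hx
    have h1 : ¬ ∃ᶠ d in atTop, x ∈ D k d := fun h =>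
      hx.2 (hZN (Set.mem_iUnion.2 ⟨k, mem_limsup_iff_frequently_mem.2 h⟩))
    rw [not_frequently, eventually_atTop] at h1
    obtain ⟨d₀, hd₀⟩ := h1
    obtain ⟨d₁, hd₁, hx₁⟩ := frequently_atTop.1 hx.1 d₀
    refine eventually_atTop.2 ⟨d₁, fun d hd => ?_⟩
    induction d, hd using Nat.le_induction with
    | base => exact hx₁
    | succ d hd ih => exact (hmemU k d (hd₀ d (by omega))).1 ih
  refine ⟨B, fun k => ⟨(hE k).height_pos, ?_, ?_⟩, fun k => ?_, fun k => ?_⟩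
  · exact (MeasurableSet.measurableSet_limsup fun d => (hcol d k).measurable_base).diff hNm
  · intro i hi j hj hij
    rw [Set.disjoint_left]
    intro x hx hx'
    rw [mem_img] at hx hx'
    obtain ⟨d, hd, hd'⟩ := ((hevent hx).and (hevent hx')).exists
    rw [← mem_img] at hd hd'
    exact Set.disjoint_left.1 ((hcol d k).disjoint_levels i hi j hj hij) hd hd'
  · ext x
    rw [mem_cutUnion, hBmem]
    have hshift : (∃ᶠ d in atTop, x ∈ U k d) ↔ ∃ᶠ d in atTop, x ∈ U k (d + 1) := by
      rw [frequently_atTop, frequently_atTop]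
      constructor
      · intro h a
        obtain ⟨b, hb, hx⟩ := h (a + 1)
        exact ⟨b - 1, by omega, by rwa [Nat.sub_add_cancel (by omega)]⟩
      · intro h a
        obtain ⟨b, hb, hx⟩ := h a
        exact ⟨b + 1, by omega, hx⟩
    rw [hshift]
    simp only [hUs, mem_cutUnion, mem_img, hBmem, hsymmN]
    constructor
    · rintro ⟨h, hxN⟩
      -- Pigeonhole over the finitely many subcolumns: one index i must occur for infinitely many d.
      have h' : ∃ᶠ d in atTop, ∃ i ∈ Finset.range (r k),
          (⇑T.symm)^[∑ l ∈ Finset.range i, (g k + s k l)] x ∈ U (k + 1) d :=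
        h.mono fun d ⟨i, hi, hx⟩ => ⟨i, Finset.mem_range.2 hi, hx⟩
      by_contra! hcon
      refine h' ?_
      have : ∀ᶠ d in atTop, ∀ i ∈ Finset.range (r k),
          (⇑T.symm)^[∑ l ∈ Finset.range i, (g k + s k l)] x ∉ U (k + 1) d := by
        rw [eventually_all_finset]
        intro i hi
        rw [← not_frequently]
        exact fun hf => hxN (hcon i (Finset.mem_range.1 hi) hf)
      filter_upwards [this] with d hd
      rintro ⟨i, hi, hx⟩
      exact hd i hi hx
    · rintro ⟨i, hi, h, hxN⟩
      exact ⟨h.mono fun d hd => ⟨i, hi, hd⟩, hxN⟩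
  · have hsub : symmDiff (E k) (B k) ⊆ (⋃ d, D k d) ∪ N := by
      intro x hx
      by_contra hcon
      rw [Set.mem_union, not_or, Set.mem_iUnion, not_exists] at hcon
      have hall : ∀ d, x ∈ U k d ↔ x ∈ E k := by
        intro d
        induction d with
        | zero => rw [hU0]
        | succ d ih => rw [← ih, hmemU k d (hcon.1 d)]
      have : x ∈ B k ↔ x ∈ E k := by
        rw [hBmem]
        simp [hall, hcon.2]
      rw [Set.mem_symmDiff] at hx
      tauto
    calc g k * μ (symmDiff (E k) (B k)) ≤ g k * ∑' d, μ (D k d) := by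
          gcongr
          refine (measure_mono hsub).trans ((measure_union_le _ _).trans ?_)
          rw [hN0, add_zero]
          exact measure_iUnion_le _
      _ = ∑' d, g k * μ (D k d) := ENNReal.tsum_mul_left.symm
      _ ≤ _ := ENNReal.tsum_le_tsum fun d => hstep d k

end Limits

/-! ### Existence of a presentation. -/

section Existence

variable {X : Type*} [MeasurableSpace X] {T : X ≃ᵐ X} {μ : Measure X}

/-- A column of positive finite measure. -/
structure Tower (T : X ≃ᵐ X) (μ : Measure X) where
  base : Set X
  height : ℕ
  isColumn : IsColumn T base height
  pos : 0 < μ base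
  lt_top : μ base < ⊤

/-- The symmetric difference of two unions of levels over different bases. -/
theorem measure_symmDiff_levels_le (hT : MeasurePreserving T μ μ) (S : Finset ℕ) (E B : Set X) :
    μ (symmDiff (⋃ i ∈ S, img T i E) (⋃ i ∈ S, img T i B)) ≤ S.card * μ (symmDiff E B) := by
  refine (measure_mono ?_).trans (measure_iUnion_img_le hT S (symmDiff E B))
  rintro x (⟨hx, hx'⟩ | ⟨hx, hx'⟩) <;> simp only [Set.mem_iUnion] at hx hx' ⊢ <;>
    obtain ⟨i, hi, hxi⟩ := hx <;> refine ⟨i, hi, ?_⟩ <;> rw [img_symmDiff]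
  · exact Or.inl ⟨hxi, fun h => hx' ⟨i, hi, h⟩⟩
  · exact Or.inr ⟨hxi, fun h => hx' ⟨i, hi, h⟩⟩

/-- The base error is weighted by the height so that it bounds the error of any union of levels. The
removed part is tested on the exhausting sets `spanningSets μ k`, so it becomes negligible on each
set of finite measure. -/
theorem exists_tower_sequence [SigmaFinite μ] (hna : IsNonatomic μ) (hμ : μ ≠ 0)
    (hT : MeasurePreserving T μ μ) {B : ℕ → Set X} {h : ℕ → ℕ} (hc : ∀ n, IsColumn T (B n) (h n))
    (happ : Approximates T μ B h) (C₀ : Tower T μ) {τ : ℕ → ENNReal} (hτ : ∀ k, τ k ≠ 0) :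
    ∃ (C : ℕ → Tower T μ) (r : ℕ → ℕ) (s : ℕ → ℕ → ℕ) (n p : ℕ → ℕ), C 0 = C₀ ∧
      ∀ k, 2 ≤ r k ∧ k ≤ n k ∧ p k < h (n k) ∧ (C (k + 1)).base = img T (p k) (B (n k)) ∧
        (C (k + 1)).height = h (n k) - p k ∧
        (C (k + 1)).height = ∑ l ∈ Finset.range (r k), ((C k).height + s k l) ∧
        (C k).height * μ (symmDiff (C k).base
          (cutUnion T (C k).height (r k) (s k) (C (k + 1)).base)) ≤ τ k ∧
        μ (spanningSets μ k ∩ ⋃ i ∈ Finset.range (p k), img T i (B (n k))) ≤ τ k := by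
  have hstep : ∀ (k : ℕ) (C : Tower T μ), ∃ (C' : Tower T μ) (r : ℕ) (s : ℕ → ℕ) (n p : ℕ),
      2 ≤ r ∧ k ≤ n ∧ p < h n ∧ C'.base = img T p (B n) ∧ C'.height = h n - p ∧
        C'.height = ∑ l ∈ Finset.range r, (C.height + s l) ∧
        C.height * μ (symmDiff C.base (cutUnion T C.height r s C'.base)) ≤ τ k ∧
        μ (spanningSets μ k ∩ ⋃ i ∈ Finset.range p, img T i (B n)) ≤ τ k := by
    intro k C
    have hh : (1 : ENNReal) ≤ C.height := by exact_mod_cast C.isColumn.height_pos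
    obtain ⟨n, hn, p, hp, hB0, hBf, r, s, hr, hs, h1, h2⟩ := happ.exists_refinement hna hμ hT hc
      C.isColumn C.pos C.lt_top (measurableSet_spanningSets μ k)
      (measure_spanningSets_lt_top μ k) (ε := τ k / C.height)
      (ENNReal.div_ne_zero.2 ⟨hτ k, ENNReal.natCast_ne_top _⟩) k
    refine ⟨⟨img T p (B n), h n - p, (hc n).trim hp, by rwa [measure_img hT],
      by rwa [measure_img hT]⟩, r, s, n, p, hr, hn, hp, rfl, rfl, hs, ?_, ?_⟩
    · exact ENNReal.mul_le_of_le_div' h1.le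
    · exact h2.le.trans (ENNReal.div_le_of_le_mul (le_mul_of_one_le_right zero_le hh))
  choose C' r s n p hprop using hstep
  set C : ℕ → Tower T μ := fun k => Nat.rec C₀ (fun k C => C' k C) k with hC
  exact ⟨C, fun k => r k (C k), fun k => s k (C k), fun k => n k (C k), fun k => p k (C k), rfl,
    fun k => hprop k (C k)⟩

/-- Removing the bottom parts of the columns of an approximating sequence, and perturbing what is
left, preserves the approximation property. -/
theorem Approximates.of_trim [SigmaFinite μ] (hT : MeasurePreserving T μ μ) {B : ℕ → Set X}
    {h : ℕ → ℕ} (happ : Approximates T μ B h) {B' : ℕ → Set X} {g n p : ℕ → ℕ} {τ ρ : ℕ → ENNReal}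
    (hn : ∀ k, k ≤ n k) (hg : ∀ k, g (k + 1) = h (n k) - p k)
    (hp : ∀ k, μ (spanningSets μ k ∩ ⋃ i ∈ Finset.range (p k), img T i (B (n k))) ≤ τ k)
    (hB' : ∀ k, g (k + 1) * μ (symmDiff (img T (p k) (B (n k))) (B' (k + 1))) ≤ ρ (k + 1))
    (hτ : Tendsto τ atTop (𝓝 0)) (hρ : Tendsto ρ atTop (𝓝 0)) : Approximates T μ B' g := by
  intro A hA hAf ε hε
  -- The four errors: the given approximation, the mass of A outside `spanningSets μ k`, the removed
  -- levels, and the perturbation of the base.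
  have hε4 : 0 < ε / 4 := ENNReal.div_pos hε.ne' (by norm_num)
  obtain ⟨N, hN⟩ := happ A hA hAf (ε / 4) hε4
  have hspan : Tendsto (fun k => μ (A \ spanningSets μ k)) atTop (𝓝 0) := by
    have hlim := tendsto_measure_iInter_atTop (μ := μ) (s := fun k => A \ spanningSets μ k)
      (fun k => (hA.diff (measurableSet_spanningSets μ k)).nullMeasurableSet)
      (fun i j hij => Set.sdiff_subset_sdiff_right (monotone_spanningSets μ hij))
      ⟨0, measure_ne_top_of_subset Set.sdiff_subset hAf.ne⟩
    rwa [← Set.sdiff_iUnion, iUnion_spanningSets, Set.sdiff_univ, measure_empty] at hlim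
  have hev := ((hspan.eventually_lt_const hε4).and ((hτ.eventually_lt_const hε4).and
    (((tendsto_add_atTop_iff_nat 1).2 hρ).eventually_lt_const hε4))).and (eventually_ge_atTop N)
  obtain ⟨K, hK⟩ := eventually_atTop.1 hev
  refine ⟨K + 1, fun m hm => ?_⟩
  obtain ⟨k, rfl⟩ : ∃ k, m = k + 1 := ⟨m - 1, by omega⟩
  obtain ⟨⟨h1, h2, h3⟩, h4⟩ := hK k (by omega)
  obtain ⟨S, hS, hAS⟩ := hN (n k) (h4.trans (hn k))
  set S' := (Finset.range (g (k + 1))).filter fun i => i + p k ∈ S with hS'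
  refine ⟨S', Finset.filter_subset _ _, ?_⟩
  set L := B (n k) with hL
  set V := ⋃ i ∈ S', img T i (img T (p k) L) with hV
  have hsub : symmDiff A V ⊆ symmDiff A (⋃ i ∈ S, img T i L) ∪ ((A \ spanningSets μ k) ∪
      (spanningSets μ k ∩ ⋃ i ∈ Finset.range (p k), img T i L)) := by
    rintro x (⟨hxA, hx⟩ | ⟨hx, hxA⟩)
    · by_cases hxS : x ∈ ⋃ i ∈ S, img T i L
      · right
        by_cases hxY : x ∈ spanningSets μ k
        · refine Or.inr ⟨hxY, ?_⟩
          simp only [hV, img_img, Set.mem_iUnion] at hx hxS ⊢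
          obtain ⟨i, hi, hxi⟩ := hxS
          refine ⟨i, ?_, hxi⟩
          rw [Finset.mem_range]
          by_contra! hle
          refine hx ⟨i - p k, Finset.mem_filter.2 ⟨?_, ?_⟩, ?_⟩
          · have := Finset.mem_range.1 (hS hi)
            rw [Finset.mem_range, hg]
            omega
          · rwa [Nat.sub_add_cancel hle]
          · rwa [Nat.sub_add_cancel hle]
        · exact Or.inl ⟨hxA, hxY⟩
      · exact Or.inl (Or.inl ⟨hxA, hxS⟩)
    · refine Or.inl (Or.inr ⟨?_, hxA⟩)
      simp only [hV, img_img, Set.mem_iUnion] at hx ⊢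
      obtain ⟨i, hi, hxi⟩ := hx
      exact ⟨i + p k, (Finset.mem_filter.1 hi).2, hxi⟩
  have hcard : (S'.card : ENNReal) ≤ g (k + 1) := by
    have := Finset.card_le_card (Finset.filter_subset (fun i => i + p k ∈ S)
      (Finset.range (g (k + 1))))
    rw [Finset.card_range] at this
    exact_mod_cast this
  have h5 : μ (symmDiff V (⋃ i ∈ S', img T i (B' (k + 1)))) < ε / 4 := by
    refine lt_of_le_of_lt ?_ h3
    refine (measure_symmDiff_levels_le hT S' _ _).trans (le_trans ?_ (hB' k))
    gcongr
  calc _ ≤ μ (symmDiff A V) + μ (symmDiff V (⋃ i ∈ S', img T i (B' (k + 1)))) :=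
        measure_symmDiff_le _ _ _
    _ ≤ (μ (symmDiff A (⋃ i ∈ S, img T i L)) + (μ (A \ spanningSets μ k) +
          μ (spanningSets μ k ∩ ⋃ i ∈ Finset.range (p k), img T i L))) +
          μ (symmDiff V (⋃ i ∈ S', img T i (B' (k + 1)))) := by
        gcongr
        exact (measure_mono hsub).trans ((measure_union_le _ _).trans
          (add_le_add le_rfl (measure_union_le _ _)))
    _ < (ε / 4 + (ε / 4 + ε / 4)) + ε / 4 :=
        ENNReal.add_lt_add (ENNReal.add_lt_add hAS (ENNReal.add_lt_add h1 ((hp k).trans_lt h2))) h5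
    _ = ε := by
        rw [show ε / 4 + (ε / 4 + ε / 4) + ε / 4 = 4 * (ε / 4) by ring]
        exact ENNReal.mul_div_cancel (by norm_num) (by norm_num)

theorem IsRankOne.nonempty_cuttingStacking [SigmaFinite μ] (hna : IsNonatomic μ) (hμ : μ ≠ 0)
    (hT : MeasurePreserving T μ μ) (hrank : IsRankOne T μ) : Nonempty (CuttingStacking T μ) := by
  obtain ⟨B, h, hc, happ⟩ := hrank
  obtain ⟨I, hI, -, hI0, hIf⟩ := Measure.exists_subset_measure_lt_top (μ := μ) (r := 0)
    MeasurableSet.univ (Measure.measure_univ_pos.2 hμ)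
  -- Any I of positive finite measure can start the construction. A total error below μ(I) keeps the
  -- corrected initial base of positive measure, the initial height being 1.
  obtain ⟨τ', hτ'0, hτ'⟩ := ENNReal.exists_pos_sum_of_countable hI0.ne' ℕ
  set τ : ℕ → ENNReal := fun k => τ' k with hτdef
  have hτ0 : ∀ k, τ k ≠ 0 := fun k => by
    simpa [hτdef] using (hτ'0 k).ne'
  have hτsum : ∑' k, τ k ≠ ⊤ := hτ'.ne_top
  set C₀ : Tower T μ := ⟨I, 1, ⟨one_pos, hI, fun i hi j hj hij => by omega⟩, hI0, hIf⟩ with hC₀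
  obtain ⟨C, r, s, n, p, hC0, hC⟩ := exists_tower_sequence hna hμ hT hc happ C₀ hτ0
  choose hr hn hp hbase hheight hg hclose hlost using hC
  obtain ⟨B', hcol, hcut, hdist⟩ := exists_exact_columns hT (E := fun k => (C k).base)
    (g := fun k => (C k).height) (fun k => (C k).isColumn) hg hclose hτsum
  have hh0 : (C 0).height = 1 := by rw [hC0]
  have hd0 : μ (symmDiff I (B' 0)) < μ I := by
    have := hdist 0
    simp only [hC0, hC₀, add_zero, Nat.cast_one, one_mul] at this
    exact this.trans_lt hτ'
  refine ⟨⟨B', fun k => (C k).height, r, s, hcol, hh0, ?_, ?_, hr, hg, hcut, ?_⟩⟩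
  · refine pos_iff_ne_zero.2 fun h0 => hd0.not_ge ?_
    calc μ I ≤ μ (symmDiff I (B' 0) ∪ B' 0) := measure_mono fun x hx => by
          by_cases hx' : x ∈ B' 0
          · exact Or.inr hx'
          · exact Or.inl (Or.inl ⟨hx, hx'⟩)
      _ ≤ _ := measure_union_le _ _
      _ = _ := by rw [h0, add_zero]
  · calc μ (B' 0) ≤ μ (symmDiff I (B' 0) ∪ I) := measure_mono fun x hx => by
          by_cases hx' : x ∈ I
          · exact Or.inr hx'
          · exact Or.inl (Or.inr ⟨hx, hx'⟩)
      _ ≤ _ := measure_union_le _ _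
      _ < ⊤ := ENNReal.add_lt_top.2 ⟨hd0.trans hIf, hIf⟩
  · refine happ.of_trim hT (ρ := fun k => ∑' d, τ (d + k)) hn hheight hlost (fun k => ?_)
      (ENNReal.tendsto_atTop_zero_of_tsum_ne_top hτsum) (ENNReal.tendsto_sum_nat_add τ hτsum)
    rw [← hbase]
    exact hdist (k + 1)

end Existence

end RankOne

theorem mainTheorem3 {X : Type*} [MeasurableSpace X] (μ : Measure X) [SigmaFinite μ]
    (hμ : μ ≠ 0) (hna : RankOne.IsNonatomic μ) (T : X ≃ᵐ X) (hT : MeasurePreserving T μ μ)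
    (hrank : RankOne.IsRankOne T μ) :
    Nonempty (RankOne.CuttingStacking T μ) ∧
      ∀ C : RankOne.CuttingStacking T μ,
        RankOne.SubseqWeaklyRationallyErgodic T μ (fun m => C.maxHeight m + 1) (C.base 0) :=
  ⟨hrank.nonempty_cuttingStacking hna hμ hT, fun C => C.subseqWeaklyRationallyErgodic hT⟩
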